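/- Let $d\in\{2,3\}$, let $\Omega\subset\mathbb R^d$ be a bounded convex polytopal domain, and let $f\in L^2(\Omega)$. Let $A\colon\Omega\to\mathbb R^{d\times d}_{\rm sym}$ be measurable with $0<\operatorname{ess\,inf}_\Omega\lambda_{\min}(A)\le\operatorname{ess\,sup}_\Omega\lambda_{\max}(A)<\infty$, and suppose that $A$ satisfies the Cordes condition: for some $0<\varepsilon\le1$, $$\frac{\sum_{j,k}A_{jk}^2}{\big(\sum_jA_{jj}\big)^2}\le\frac1{d-1+\varepsilon}\qquad\text{a.e. in }\Omega.$$ Let $\mathcal T$ be a finite partition of $\Omega$ into pairwise disjoint open Lipschitz subdomains $T\subseteq\Omega$ of positive measure with $\bigcup_{T\in\mathcal T}\overline T=\overline\Omega$. Notation. Write $(\cdot,\cdot)_\omega$ for the inner products of $L^2(\omega)$ and $L^2(\omega)^{d\times d}$ (with the Frobenius product $M:Q$), and $(\cdot,\cdot)=(\cdot,\cdot)_\Omega$. Let $L^2_{\rm sym}(\omega)\subset L^2(\omega)^{d\times d}$ be the subspace of symmetric matrix fields, and let $X=H^2(\Omega)\cap H^1_0(\Omega)$. Let $H(\operatorname{div}\mathbf{Div};\omega)$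 be the completion of $\mathcal D(\overline\omega)^{d\times d}\cap L^2_{\rm sym}(\omega)$ (symmetric matrix fields that are smooth up to the boundary) in the norm $\big(\|Q\|_\omega^2+\|\operatorname{div}\mathbf{Div}\,Q\|_\omega^2\big)^{1/2}$, where $\operatorname{div}\mathbf{Div}\,Q=\sum_{i,j}\partial_i\partial_jQ_{ij}$, and let $H(\operatorname{div}\mathbf{Div};\mathcal T)=\prod_{T\in\mathcal T}H(\operatorname{div}\mathbf{Div};T)$, whose elements are regarded as elements of $L^2_{\rm sym}(\Omega)$. For $u\in H^2(\Omega)$ define $\operatorname{tr}^2_{\mathcal T}u\in H(\operatorname{div}\mathbf{Div};\mathcal T)'$ by $$\langle\operatorname{tr}^2_{\mathcal T}u,Q\rangle=\sum_{T\in\mathcal T}\big((\operatorname{div}\mathbf{Div}\,Q,u)_T-(Q,D^2u)_T\big),$$ and set $\widehat U=\operatorname{tr}^2_{\mathcal T}(X)$, $U=L^2(\Omega)\times L^2_{\rm sym}(\Omega)\times\widehat U$ and $V=L^2(\Omega)\times H(\operatorname{div}\mathbf{Div};\mathcal T)$. The strong problem is to find $u\in X$ with $A:D^2u=f$ a.e.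 in $\Omega$. The ultraweak formulation is to find $(u,M,\widehat u)\in U$ such that $$-\sum_{T\in\mathcal T}(u,\operatorname{div}\mathbf{Div}\,Q)_T+(M,Av+Q)+\langle\widehat u,Q\rangle=(f,v)\qquad\text{for all }(v,Q)\in V.$$ Proposition. The two problems are equivalent in the following sense. If $u\in X$ solves the strong problem, then $(u,D^2u,\operatorname{tr}^2_{\mathcal T}u)$ belongs to $U$ and solves the ultraweak formulation. Conversely, if $(u,M,\widehat u)\in U$ solves the ultraweak formulation, then $u\in X$ and $u$ solves the strong problem. -/

import Mathlib

noncomputable section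

open MeasureTheory
open scoped ContDiff

namespace Ultraweak

/-- Euclidean space `ℝ^d`. -/
abbrev E (d : ℕ) : Type := EuclideanSpace ℝ (Fin d)

/-! ### Domains and meshes -/

/-- A bounded convex polytopal domain: the nonempty interior of the convex hull of finitely many
points. -/
def IsConvexPolytopalDomain {d : ℕ} (Ω : Set (E d)) : Prop :=
  Ω.Nonempty ∧ ∃ P : Finset (E d), Ω = interior (convexHull ℝ (P : Set (E d)))

/-- A bounded Lipschitz domain: bounded, open, connected, and near each of its boundary points, in
a suitable Cartesian coordinate system with last axis `ν`, the strict epigraph of a Lipschitz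
function `h` of the remaining coordinates `y - ⟪ν, y⟫ ν`. -/
structure IsLipschitzDomain {d : ℕ} (T : Set (E d)) : Prop where
  isOpen : IsOpen T
  isConnected : IsConnected T
  isBounded : Bornology.IsBounded T
  boundary : ∀ x ∈ frontier T, ∃ (ν : E d) (r : ℝ) (K : NNReal) (h : E d → ℝ),
    ‖ν‖ = 1 ∧ 0 < r ∧ LipschitzWith K h ∧
      T ∩ Metric.ball x r =
        {y | h (y - inner ℝ ν y • ν) < inner ℝ ν y} ∩ Metric.ball x r

/-- A (finite) partition of `Ω` into non-intersecting Lipschitz subdomains of positive measure. -/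
structure Mesh {d : ℕ} (Ω : Set (E d)) (ι : Type*) where
  elem : ι → Set (E d)
  lipschitz : ∀ T, IsLipschitzDomain (elem T)
  subset : ∀ T, elem T ⊆ Ω
  disjoint : Pairwise fun T T' => Disjoint (elem T) (elem T')
  measure_pos : ∀ T, 0 < volume (elem T)
  cover : ⋃ T, closure (elem T) = closure Ω

/-! ### Spaces of square integrable functions -/

/-- `L²(S)`. -/
abbrev L2 {d : ℕ} (S : Set (E d)) : Type := Lp ℝ 2 (volume.restrict S)

/-- `L²(S)^d`. -/
abbrev L2vec {d : ℕ} (S : Set (E d)) : Type := PiLp 2 fun _ : Fin d => L2 S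

/-- `L²(S)^{d×d}`, whose inner product is `∫_S M : Q`. -/
abbrev L2mat {d : ℕ} (S : Set (E d)) : Type := PiLp 2 fun _ : Fin d × Fin d => L2 S

/-- The symmetric elements of `L²(S)^{d×d}`. -/
def L2sym {d : ℕ} (S : Set (E d)) : Set (L2mat S) := {Q | ∀ i j, Q (i, j) = Q (j, i)}

/-- The restriction `L²(Ω) → L²(S)` for `S ⊆ Ω`. -/
def restrictL2 {d : ℕ} {Ω S : Set (E d)} (h : S ⊆ Ω) (u : L2 Ω) : L2 S :=
  ((Lp.memLp u).mono_measure (Measure.restrict_mono_set volume h)).toLp u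

/-! ### Sobolev spaces -/

/-- The classical partial derivative `∂φ/∂x_i`. -/
def pderiv {d : ℕ} (i : Fin d) (φ : E d → ℝ) (x : E d) : ℝ :=
  fderiv ℝ φ x (EuclideanSpace.single i 1)

/-- `φ ∈ C_c^∞(S)`. -/
structure IsTestFunction {d : ℕ} (S : Set (E d)) (φ : E d → ℝ) : Prop where
  smooth : ContDiff ℝ ∞ φ
  compact : HasCompactSupport φ
  support : tsupport φ ⊆ S

/-- `g` is the weak partial derivative `∂u/∂x_i` in `S`. -/
def HasWeakPartial {d : ℕ} (S : Set (E d)) (i : Fin d) (u g : L2 S) : Prop :=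
  ∀ φ : E d → ℝ, IsTestFunction S φ →
    ∫ x in S, u x * pderiv i φ x = -∫ x in S, g x * φ x

/-- `u` has a weak gradient in `L²(S)^d`, and `H ∈ L²(S)^{d×d}` is its weak Hessian. -/
def IsWeakHessian {d : ℕ} (S : Set (E d)) (u : L2 S) (H : L2mat S) : Prop :=
  ∃ g : L2vec S, (∀ i, HasWeakPartial S i u (g i)) ∧
    ∀ i j, HasWeakPartial S j (g i) (H (i, j))

/-- The Sobolev space `H²(S)`. -/
def H2 {d : ℕ} (S : Set (E d)) : Set (L2 S) := {u | ∃ H, IsWeakHessian S u H}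

open Classical in
/-- The Hessian `D²u` of `u ∈ H²(S)` (and `0` for other `u`). For open `S` the weak Hessian is
unique. -/
def D2 {d : ℕ} {S : Set (E d)} (u : L2 S) : L2mat S :=
  if h : ∃ H, IsWeakHessian S u H then h.choose else 0

/-- The Sobolev space `H_0^1(S)`: the closure of `C_c^∞(S)` in `H¹(S)`. It consists of the `u` such
that `(u, ∇u)` is a limit of pairs `(φ, ∇φ)` in `L²(S) × L²(S)^d`. -/
def H10 {d : ℕ} (S : Set (E d)) : Set (L2 S) :=
  {u | ∃ g : L2vec S, (u, g) ∈ closure {p : L2 S × L2vec S |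
    ∃ φ : E d → ℝ, IsTestFunction S φ ∧ p.1 =ᵐ[volume.restrict S] φ ∧
      ∀ i, p.2 i =ᵐ[volume.restrict S] pderiv i φ}}

/-- `X = H²(Ω) ∩ H_0^1(Ω)`. -/
def X {d : ℕ} (Ω : Set (E d)) : Set (L2 Ω) := H2 Ω ∩ H10 Ω

/-! ### The space `H(div Div)` -/

/-- A smooth symmetric matrix field on `ℝ^d` with compact support. The restrictions of such fields
to `S` form `𝒟(cl S)^{d×d} ∩ L²_sym(S)`. -/
structure IsSmoothSym {d : ℕ} (Q : Fin d → Fin d → E d → ℝ) : Prop where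
  smooth : ∀ i j, ContDiff ℝ ∞ (Q i j)
  compact : ∀ i j, HasCompactSupport (Q i j)
  symm : ∀ i j, Q i j = Q j i

/-- The classical `div Div Q = ∑_i ∂_i ∑_j ∂_j Q_ij`. -/
def dDivClassical {d : ℕ} (Q : Fin d → Fin d → E d → ℝ) (x : E d) : ℝ :=
  ∑ i, ∑ j, pderiv i (pderiv j (Q i j)) x

theorem pderiv_contDiff {d : ℕ} (i : Fin d) {φ : E d → ℝ} (h : ContDiff ℝ ∞ φ) :
    ContDiff ℝ ∞ (pderiv i φ) :=
  (h.fderiv_right (m := ∞) le_rfl).clm_apply contDiff_const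

theorem pderiv_add {d : ℕ} (i : Fin d) {φ ψ : E d → ℝ} (h : ContDiff ℝ ∞ φ)
    (h' : ContDiff ℝ ∞ ψ) : pderiv i (φ + ψ) = pderiv i φ + pderiv i ψ := by
  funext x
  have a := (h.differentiable (by simp)) x
  have b := (h'.differentiable (by simp)) x
  simp [pderiv, fderiv_add a b]

theorem pderiv_smul {d : ℕ} (i : Fin d) (c : ℝ) {φ : E d → ℝ} (h : ContDiff ℝ ∞ φ) :
    pderiv i (c • φ) = c • pderiv i φ := by
  funext x
  have a := (h.differentiable (by simp)) x
  simp [pderiv, fderiv_const_smul a]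

theorem dDivClassical_add {d : ℕ} {Q R : Fin d → Fin d → E d → ℝ} (hQ : IsSmoothSym Q)
    (hR : IsSmoothSym R) : dDivClassical (Q + R) = dDivClassical Q + dDivClassical R := by
  funext x
  have : ∀ i j, pderiv i (pderiv j ((Q + R) i j)) =
      pderiv i (pderiv j (Q i j)) + pderiv i (pderiv j (R i j)) := fun i j => by
    rw [Pi.add_apply, Pi.add_apply, pderiv_add j (hQ.smooth i j) (hR.smooth i j),
      pderiv_add i (pderiv_contDiff j (hQ.smooth i j)) (pderiv_contDiff j (hR.smooth i j))]
  simp only [dDivClassical, this]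
  simp only [dDivClassical, Pi.add_apply, Finset.sum_add_distrib]

theorem dDivClassical_smul {d : ℕ} (c : ℝ) {Q : Fin d → Fin d → E d → ℝ} (hQ : IsSmoothSym Q) :
    dDivClassical (c • Q) = c • dDivClassical Q := by
  funext x
  have : ∀ i j, pderiv i (pderiv j ((c • Q) i j)) = c • pderiv i (pderiv j (Q i j)) :=
    fun i j => by
      rw [Pi.smul_apply, Pi.smul_apply, pderiv_smul j c (hQ.smooth i j),
        pderiv_smul i c (pderiv_contDiff j (hQ.smooth i j))]
  simp only [dDivClassical, this]
  simp only [dDivClassical, Pi.smul_apply, Finset.smul_sum]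

/-- The pairs `(Q, div Div Q)` with `Q ∈ 𝒟(cl S)^{d×d} ∩ L²_sym(S)`, inside the Hilbert space
`L²(S)^{d×d} × L²(S)`. -/
def smoothGraph {d : ℕ} (S : Set (E d)) : Submodule ℝ (WithLp 2 (L2mat S × L2 S)) where
  carrier := {p | ∃ Q : Fin d → Fin d → E d → ℝ, IsSmoothSym Q ∧
    (∀ i j, p.fst (i, j) =ᵐ[volume.restrict S] Q i j) ∧
    p.snd =ᵐ[volume.restrict S] dDivClassical Q}
  zero_mem' := by
    refine ⟨0, ⟨fun i j => contDiff_const, fun i j => HasCompactSupport.zero, fun i j => rfl⟩,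
      fun i j => ?_, ?_⟩
    · exact Lp.coeFn_zero _ _ _
    · have : dDivClassical (0 : Fin d → Fin d → E d → ℝ) = 0 := by
        funext x
        have h0 : ∀ j : Fin d, pderiv j (0 : E d → ℝ) = 0 := fun j => by
          funext y; simp [pderiv]
        simp [dDivClassical, h0]
      rw [this]
      exact Lp.coeFn_zero _ _ _
  add_mem' := by
    rintro p q ⟨Q, hQ, h1, h2⟩ ⟨R, hR, h3, h4⟩
    refine ⟨Q + R, ⟨fun i j => (hQ.smooth i j).add (hR.smooth i j),
      fun i j => (hQ.compact i j).add (hR.compact i j), fun i j => ?_⟩, fun i j => ?_, ?_⟩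
    · simp [hQ.symm i j, hR.symm i j]
    · exact (Lp.coeFn_add _ _).trans ((h1 i j).add (h3 i j))
    · rw [dDivClassical_add hQ hR]
      exact (Lp.coeFn_add _ _).trans (h2.add h4)
  smul_mem' := by
    rintro c p ⟨Q, hQ, h1, h2⟩
    refine ⟨c • Q, ⟨fun i j => (hQ.smooth i j).const_smul c,
      fun i j => (hQ.compact i j).smul_left (f := fun _ => c), fun i j => ?_⟩, fun i j => ?_, ?_⟩
    · simp [hQ.symm i j]
    · exact (Lp.coeFn_smul _ _).trans ((h1 i j).const_smul c)
    · rw [dDivClassical_smul c hQ]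
      exact (Lp.coeFn_smul _ _).trans (h2.const_smul c)

/-- `H(div Div; S)`: the completion of `𝒟(cl S)^{d×d} ∩ L²_sym(S)` in the norm
`(‖Q‖² + ‖div Div Q‖²)^{1/2}`. Since `Q ↦ (Q, div Div Q)` is isometric from this norm to
`L²(S)^{d×d} × L²(S)`, the completion is the closure of the image there. -/
abbrev HdDiv {d : ℕ} (S : Set (E d)) : Type := ↥(smoothGraph S).topologicalClosure

namespace HdDiv

/-- The matrix field underlying an element of `H(div Div; S)`. -/
def field {d : ℕ} {S : Set (E d)} : HdDiv S →L[ℝ] L2mat S :=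
  (WithLp.fstL 2 ℝ (L2mat S) (L2 S)).comp (Submodule.subtypeL _)

/-- `div Div Q ∈ L²(S)` for `Q ∈ H(div Div; S)`. -/
def dDiv {d : ℕ} {S : Set (E d)} : HdDiv S →L[ℝ] L2 S :=
  (WithLp.sndL 2 ℝ (L2mat S) (L2 S)).comp (Submodule.subtypeL _)

end HdDiv

/-- `H(div Div; 𝒯) = ∏_T H(div Div; T)`. -/
abbrev BrokenHdDiv {d : ℕ} {Ω : Set (E d)} {ι : Type*} (𝒯 : Mesh Ω ι) : Type _ :=
  PiLp 2 fun T => HdDiv (𝒯.elem T)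

/-- An element of `H(div Div; 𝒯)` as a matrix field on `Ω`, defined elementwise. -/
def BrokenHdDiv.field {d : ℕ} {Ω : Set (E d)} {ι : Type*} [Fintype ι] {𝒯 : Mesh Ω ι}
    (Q : BrokenHdDiv 𝒯) (i j : Fin d) (x : E d) : ℝ :=
  ∑ T, (𝒯.elem T).indicator (HdDiv.field (Q T) (i, j)) x

/-! ### Traces -/

/-- The trace `tr²_S u ∈ H(div Div; S)'` of `u ∈ H²(S)`:
`Q ↦ (div Div Q, u)_S - (Q, D²u)_S`. -/
def tr2 {d : ℕ} {S : Set (E d)} (u : L2 S) : HdDiv S →L[ℝ] ℝ :=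
  (innerSL ℝ u).comp HdDiv.dDiv - (innerSL ℝ (D2 u)).comp HdDiv.field

/-- The collective trace `tr²_𝒯 u ∈ H(div Div; 𝒯)'` of `u ∈ H²(Ω)`:
`Q ↦ ∑_T ⟨tr²_T u, Q⟩_{∂T}`. -/
def tr2Mesh {d : ℕ} {Ω : Set (E d)} {ι : Type*} [Fintype ι] (𝒯 : Mesh Ω ι) (u : L2 Ω) :
    BrokenHdDiv 𝒯 →L[ℝ] ℝ :=
  ∑ T, (tr2 (restrictL2 (𝒯.subset T) u)).comp (PiLp.proj 2 (fun T => HdDiv (𝒯.elem T)) T)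

/-- The trace space `Û = tr²_𝒯(X)`. -/
def Uhat {d : ℕ} {Ω : Set (E d)} {ι : Type*} [Fintype ι] (𝒯 : Mesh Ω ι) :
    Set (BrokenHdDiv 𝒯 →L[ℝ] ℝ) := tr2Mesh 𝒯 '' X Ω

/-! ### The problems -/

/-- The assumptions on the coefficient matrix: measurable, symmetric, uniformly elliptic and bounded
(the essential infimum of the smallest eigenvalue is positive and the essential supremum of the
largest one is finite), and the Cordes condition. -/
structure IsCordesCoefficient {d : ℕ} (Ω : Set (E d)) (A : E d → Matrix (Fin d) (Fin d) ℝ) :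
    Prop where
  measurable : ∀ i j, AEStronglyMeasurable (fun x => A x i j) (volume.restrict Ω)
  symm : ∀ᵐ x ∂volume.restrict Ω, (A x).IsSymm
  elliptic : ∃ lmin lmax : ℝ, 0 < lmin ∧
    ∀ᵐ x ∂volume.restrict Ω, ∀ μ ∈ spectrum ℝ (A x), lmin ≤ μ ∧ μ ≤ lmax
  cordes : ∃ ε : ℝ, 0 < ε ∧ ε ≤ 1 ∧ ∀ᵐ x ∂volume.restrict Ω,
    (∑ j, ∑ k, A x j k ^ 2) / (∑ j, A x j j) ^ 2 ≤ 1 / ((d : ℝ) - 1 + ε)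

/-- `u ∈ X` solves the strong problem `A : D²u = f` in `Ω`, `u = 0` on `∂Ω`. -/
def SolvesStrong {d : ℕ} {Ω : Set (E d)} (A : E d → Matrix (Fin d) (Fin d) ℝ) (f u : L2 Ω) :
    Prop :=
  u ∈ X Ω ∧ ∀ᵐ x ∂volume.restrict Ω, ∑ j, ∑ k, A x j k * D2 u (j, k) x = f x

/-- The trial space `U = L²(Ω) × L²_sym(Ω) × Û`. -/
def U {d : ℕ} {Ω : Set (E d)} {ι : Type*} [Fintype ι] (𝒯 : Mesh Ω ι) :
    Set (L2 Ω × L2mat Ω × (BrokenHdDiv 𝒯 →L[ℝ] ℝ)) :=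
  {p | p.2.1 ∈ L2sym Ω ∧ p.2.2 ∈ Uhat 𝒯}

/-- The test space `V = L²(Ω) × H(div Div; 𝒯)`. -/
abbrev V {d : ℕ} {Ω : Set (E d)} {ι : Type*} (𝒯 : Mesh Ω ι) : Type _ := L2 Ω × BrokenHdDiv 𝒯

/-- The bilinear form
`b((u, M, û), (v, Q)) = (u, -div Div Q)_𝒯 + (M, A v + Q) + ⟨û, Q⟩`. -/
def b {d : ℕ} {Ω : Set (E d)} {ι : Type*} [Fintype ι] (𝒯 : Mesh Ω ι)
    (A : E d → Matrix (Fin d) (Fin d) ℝ)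
    (p : L2 Ω × L2mat Ω × (BrokenHdDiv 𝒯 →L[ℝ] ℝ)) (q : V 𝒯) : ℝ :=
  (∑ T, inner ℝ (restrictL2 (𝒯.subset T) p.1) (-HdDiv.dDiv (q.2 T))) +
    (∫ x in Ω, ∑ i, ∑ j,
      p.2.1 (i, j) x * (A x i j * q.1 x + BrokenHdDiv.field q.2 i j x)) +
    p.2.2 q.2

/-- The right-hand side functional `F(v, Q) = (f, v)`. -/
def F {d : ℕ} {Ω : Set (E d)} {ι : Type*} (𝒯 : Mesh Ω ι) (f : L2 Ω) (q : V 𝒯) : ℝ :=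
  inner ℝ f q.1

/-- `(u, M, û) ∈ U` solves the ultraweak formulation. -/
def SolvesUltraweak {d : ℕ} {Ω : Set (E d)} {ι : Type*} [Fintype ι] (𝒯 : Mesh Ω ι)
    (A : E d → Matrix (Fin d) (Fin d) ℝ) (f : L2 Ω)
    (p : L2 Ω × L2mat Ω × (BrokenHdDiv 𝒯 →L[ℝ] ℝ)) : Prop :=
  p ∈ U 𝒯 ∧ ∀ q : V 𝒯, b 𝒯 A p q = F 𝒯 f q

end Ultraweak

end

noncomputable section

open MeasureTheory Filter Topology
open scoped ContDiff Pointwise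

namespace Ultraweak

variable {d : ℕ}

/-! ### Calculus of test functions -/

/-! If `u` is a strong solution, the trace of `u` is exactly the defect `∑_T ((div Div Q, u)_T - (Q,
D²u)_T)`, so all terms in `Q` cancel and `(A : D²u, v) = (f, v)` remains.

For the converse, write the trace unknown as the trace of some `w ∈ X`. Taking `Q = 0` gives `A : M
= f`. Taking `v = 0` and `Q` smooth on the whole space gives `(u - w, div Div Q) = (M - D²w, Q)`
with no boundary term. Thus the zero extension of `z = u - w` has the zero extension of `N = M -
D²w` as its distributional Hessian on `ℝ^d`. It remains to see that `z ∈ H_0^1(Ω)` with weak Hessian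
`N`; then `u = w + z ∈ X` and `D²u = M`.

Convexity of `Ω` settles this (`mem_closure_testGraph`): dilating towards an interior point and
mollifying turns `z` into functions `φ_n ∈ C_c^∞(Ω)` for which `(φ_n, D²φ_n)` tends weakly to `(z,
N)`. A closed subspace contains its weak limits, so `(z, N)` is also a strong limit of such pairs.
The identity `‖∂_i φ‖² = -(φ, ∂_i ∂_i φ)` makes the gradients converge too (`mem_X_of_mem_closure`).
-/

theorem hasCompactSupport_pderiv (i : Fin d) {φ : E d → ℝ} (h : HasCompactSupport φ) :
    HasCompactSupport (pderiv i φ) :=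
  h.fderiv_apply ℝ (EuclideanSpace.single i 1)

theorem tsupport_pderiv_subset (i : Fin d) (φ : E d → ℝ) : tsupport (pderiv i φ) ⊆ tsupport φ :=
  tsupport_fderiv_apply_subset ℝ (EuclideanSpace.single i 1)

namespace IsTestFunction

variable {S S' : Set (E d)} {φ ψ : E d → ℝ}

theorem pderiv (h : IsTestFunction S φ) (i : Fin d) : IsTestFunction S (pderiv i φ) :=
  ⟨pderiv_contDiff i h.smooth, hasCompactSupport_pderiv i h.compact,
    (tsupport_pderiv_subset i φ).trans h.support⟩

theorem mono (h : IsTestFunction S φ) (hS : S ⊆ S') : IsTestFunction S' φ :=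
  ⟨h.smooth, h.compact, h.support.trans hS⟩

theorem zero : IsTestFunction S (0 : E d → ℝ) :=
  ⟨contDiff_const, HasCompactSupport.zero, by simp [tsupport]⟩

theorem add (h : IsTestFunction S φ) (h' : IsTestFunction S ψ) : IsTestFunction S (φ + ψ) :=
  ⟨h.smooth.add h'.smooth, h.compact.add h'.compact,
    (tsupport_add φ ψ).trans (Set.union_subset h.support h'.support)⟩

theorem smul (c : ℝ) (h : IsTestFunction S φ) : IsTestFunction S (c • φ) :=
  ⟨h.smooth.const_smul c, h.compact.smul_left (f := fun _ => c),
    (closure_mono (Function.support_const_smul_subset c φ)).trans h.support⟩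

theorem memLp (h : IsTestFunction S φ) (p : ENNReal) (μ : Measure (E d))
    [IsFiniteMeasureOnCompacts μ] : MemLp φ p μ :=
  h.smooth.continuous.memLp_of_hasCompactSupport h.compact

theorem eq_zero_of_notMem (h : IsTestFunction S φ) {x : E d} (hx : x ∉ S) : φ x = 0 :=
  image_eq_zero_of_notMem_tsupport fun hx' => hx (h.support hx')

end IsTestFunction

theorem pderiv_sub (i : Fin d) {φ ψ : E d → ℝ} (h : ContDiff ℝ ∞ φ)
    (h' : ContDiff ℝ ∞ ψ) : pderiv i (φ - ψ) = pderiv i φ - pderiv i ψ := by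
  funext x
  have a := (h.differentiable (by simp)) x
  have b := (h'.differentiable (by simp)) x
  simp [pderiv, fderiv_sub a b]

theorem pderiv_comm (i j : Fin d) {φ : E d → ℝ} (h : ContDiff ℝ ∞ φ) :
    pderiv i (pderiv j φ) = pderiv j (pderiv i φ) := by
  have key : ∀ (k l : Fin d) (x : E d), pderiv k (pderiv l φ) x =
      fderiv ℝ (fderiv ℝ φ) x (EuclideanSpace.single k 1) (EuclideanSpace.single l 1) := by
    intro k l x
    have hd : DifferentiableAt ℝ (fderiv ℝ φ) x :=
      ((h.fderiv_right (m := ∞) le_rfl).differentiable (by simp)) x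
    change fderiv ℝ (fun y => fderiv ℝ φ y (EuclideanSpace.single l 1)) x _ = _
    rw [fderiv_clm_apply hd (differentiableAt_const _)]
    simp
  funext x
  rw [key, key]
  exact (h.contDiffAt.isSymmSndFDerivAt (by
    rw [minSmoothness_of_isRCLikeNormedField]; exact WithTop.coe_le_coe.2 (le_top : (2 : ℕ∞) ≤ ⊤))) _ _

theorem integral_mul_pderiv (i : Fin d) {φ ψ : E d → ℝ} (h : ContDiff ℝ ∞ φ)
    (h' : ContDiff ℝ ∞ ψ) (hc : HasCompactSupport φ) :
    ∫ x, φ x * pderiv i ψ x = -∫ x, pderiv i φ x * ψ x := by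
  refine integral_mul_fderiv_eq_neg_fderiv_mul_of_integrable ?_ ?_ ?_
    (fun x _ => h.differentiable (by simp) x) (fun x _ => h'.differentiable (by simp) x)
  · exact ((pderiv_contDiff i h).continuous.mul h'.continuous).integrable_of_hasCompactSupport
      (hasCompactSupport_pderiv i hc).mul_right
  · exact (h.continuous.mul (pderiv_contDiff i h').continuous).integrable_of_hasCompactSupport
      hc.mul_right
  · exact (h.continuous.mul h'.continuous).integrable_of_hasCompactSupport hc.mul_right

/-! ### Inner products in `L²` -/

theorem inner_L2 {S : Set (E d)} (u v : L2 S) : inner ℝ u v = ∫ x in S, u x * v x := by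
  rw [L2.inner_def]
  exact integral_congr_ae (ae_of_all _ fun x => by simp [mul_comm])

theorem inner_L2_of_ae {S : Set (E d)} (u v : L2 S) {φ : E d → ℝ}
    (h : v =ᵐ[volume.restrict S] φ) : inner ℝ u v = ∫ x in S, u x * φ x := by
  rw [inner_L2]
  exact integral_congr_ae (h.mono fun x hx => by simp [hx])

theorem integrable_L2_mul_test {S S' : Set (E d)} (u : L2 S) {φ : E d → ℝ}
    (h : IsTestFunction S' φ) : Integrable (fun x => u x * φ x) (volume.restrict S) :=
  (Lp.memLp u).integrable_mul (h.memLp 2 _)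

/-- A function that vanishes off `S` has the same integral over `S` as over any larger set. -/
theorem setIntegral_eq_of_vanish {S Ω : Set (E d)} (h : S ⊆ Ω)
    {g : E d → ℝ} (hg : ∀ x ∉ S, g x = 0) : ∫ x in Ω, g x = ∫ x in S, g x := by
  rw [setIntegral_eq_integral_of_forall_compl_eq_zero hg,
    setIntegral_eq_integral_of_forall_compl_eq_zero fun x hx => hg x fun hx' => hx (h hx')]

theorem restrictL2_ae {Ω S : Set (E d)} (h : S ⊆ Ω) (u : L2 Ω) :
    restrictL2 h u =ᵐ[volume.restrict S] u :=
  MemLp.coeFn_toLp _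

/-! ### Weak derivatives -/

theorem ae_eq_of_forall_test {S : Set (E d)} (hS : IsOpen S) {u v : L2 S}
    (h : ∀ φ, IsTestFunction S φ → ∫ x in S, u x * φ x = ∫ x in S, v x * φ x) : u = v := by
  have hli : LocallyIntegrableOn (fun x => u x - v x) S (volume.restrict S) := by
    have : MemLp (fun x => u x - v x) 2 (volume.restrict S) := (Lp.memLp u).sub (Lp.memLp v)
    exact (this.locallyIntegrable (by norm_num)).locallyIntegrableOn S
  have := hS.ae_eq_zero_of_integral_contDiff_smul_eq_zero hli fun g hg hc hs => by
    have ht : IsTestFunction S g := ⟨hg, hc, hs⟩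
    have := h g ht
    rw [← sub_eq_zero, ← integral_sub (integrable_L2_mul_test u ht)
      (integrable_L2_mul_test v ht)] at this
    rw [← this]
    exact integral_congr_ae (ae_of_all _ fun x => by simp; ring)
  refine Lp.ext ?_
  filter_upwards [this, ae_restrict_mem hS.measurableSet] with x hx hxS
  exact sub_eq_zero.1 (hx hxS)

theorem HasWeakPartial.unique {S : Set (E d)} (hS : IsOpen S) {i : Fin d} {u g g' : L2 S}
    (h : HasWeakPartial S i u g) (h' : HasWeakPartial S i u g') : g = g' :=
  ae_eq_of_forall_test hS fun φ hφ => by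
    have := (h φ hφ).symm.trans (h' φ hφ)
    linarith

theorem HasWeakPartial.restrict {Ω S : Set (E d)} (h : S ⊆ Ω) {i : Fin d}
    {u g : L2 Ω} (hu : HasWeakPartial Ω i u g) :
    HasWeakPartial S i (restrictL2 h u) (restrictL2 h g) := by
  intro φ hφ
  have key : ∀ (w : L2 Ω) (ψ : E d → ℝ), IsTestFunction S ψ →
      ∫ x in S, restrictL2 h w x * ψ x = ∫ x in Ω, w x * ψ x := fun w ψ hψ => by
    rw [setIntegral_eq_of_vanish h
      fun x hx => by rw [hψ.eq_zero_of_notMem hx, mul_zero]]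
    exact integral_congr_ae ((restrictL2_ae h w).mono fun x hx => by simp [hx])
  rw [key u _ (hφ.pderiv i), key g φ hφ]
  exact hu φ (hφ.mono h)

theorem HasWeakPartial.add {S : Set (E d)} {i : Fin d} {u g u' g' : L2 S}
    (h : HasWeakPartial S i u g) (h' : HasWeakPartial S i u' g') :
    HasWeakPartial S i (u + u') (g + g') := by
  intro φ hφ
  have key : ∀ (v w : L2 S) (ψ : E d → ℝ), IsTestFunction S ψ →
      ∫ x in S, (v + w : L2 S) x * ψ x = (∫ x in S, v x * ψ x) + ∫ x in S, w x * ψ x :=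
    fun v w ψ hψ => by
      rw [← integral_add (integrable_L2_mul_test v hψ) (integrable_L2_mul_test w hψ)]
      exact integral_congr_ae ((Lp.coeFn_add v w).mono fun x hx => by
        beta_reduce; rw [hx, Pi.add_apply, add_mul])
  rw [key _ _ _ (hφ.pderiv i), key _ _ _ hφ, h φ hφ, h' φ hφ, neg_add]

namespace IsWeakHessian

variable {S : Set (E d)} {u u' : L2 S} {H H' : L2mat S}

theorem unique (hS : IsOpen S) (h : IsWeakHessian S u H) (h' : IsWeakHessian S u H') :
    H = H' := by
  obtain ⟨g, hg, hH⟩ := h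
  obtain ⟨g', hg', hH'⟩ := h'
  have : g = g' := by
    ext1 i
    exact (hg i).unique hS (hg' i)
  subst this
  ext1 ⟨i, j⟩
  exact (hH i j).unique hS (hH' i j)

theorem D2_eq (hS : IsOpen S) (h : IsWeakHessian S u H) : D2 u = H := by
  have h' : ∃ H, IsWeakHessian S u H := ⟨H, h⟩
  rw [D2, dif_pos h']
  exact h'.choose_spec.unique hS h

theorem add (h : IsWeakHessian S u H) (h' : IsWeakHessian S u' H') :
    IsWeakHessian S (u + u') (H + H') := by
  obtain ⟨g, hg, hH⟩ := h
  obtain ⟨g', hg', hH'⟩ := h'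
  exact ⟨g + g', fun i => (hg i).add (hg' i), fun i j => (hH i j).add (hH' i j)⟩

theorem restrict {Ω : Set (E d)} (hSΩ : S ⊆ Ω) {u : L2 Ω} {H : L2mat Ω}
    (h : IsWeakHessian Ω u H) :
    IsWeakHessian S (restrictL2 hSΩ u) (WithLp.toLp 2 fun k => restrictL2 hSΩ (H k)) := by
  obtain ⟨g, hg, hH⟩ := h
  exact ⟨WithLp.toLp 2 fun k => restrictL2 hSΩ (g k), fun i => (hg i).restrict hSΩ,
    fun i j => (hH i j).restrict hSΩ⟩

theorem integral_mul_test (h : IsWeakHessian S u H) (i j : Fin d) {φ : E d → ℝ}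
    (hφ : IsTestFunction S φ) :
    ∫ x in S, H (i, j) x * φ x = ∫ x in S, u x * Ultraweak.pderiv i (Ultraweak.pderiv j φ) x := by
  obtain ⟨g, hg, hH⟩ := h
  rw [hg i _ (hφ.pderiv j), hH i j φ hφ, neg_neg]

/-- Tested weakly, both derivatives fall on a smooth function, where they commute. -/
theorem mem_L2sym (hS : IsOpen S) (h : IsWeakHessian S u H) : H ∈ L2sym S := fun i j =>
  ae_eq_of_forall_test hS fun φ hφ => by
    rw [h.integral_mul_test i j hφ, h.integral_mul_test j i hφ, pderiv_comm i j hφ.smooth]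

end IsWeakHessian

theorem isWeakHessian_D2 {S : Set (E d)} {u : L2 S} (h : u ∈ H2 S) : IsWeakHessian S u (D2 u) := by
  have h' : ∃ H, IsWeakHessian S u H := h
  rw [D2, dif_pos h']
  exact h'.choose_spec

theorem H10_add {S : Set (E d)} {u v : L2 S} (hu : u ∈ H10 S) (hv : v ∈ H10 S) :
    u + v ∈ H10 S := by
  obtain ⟨g, hg⟩ := hu
  obtain ⟨k, hk⟩ := hv
  refine ⟨g + k, map_mem_closure₂ (f := fun p q : L2 S × L2vec S => p + q) continuous_add hg hk ?_⟩
  rintro p ⟨φ, hφ, h1, h2⟩ q ⟨ψ, hψ, h3, h4⟩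
  refine ⟨φ + ψ, hφ.add hψ, (Lp.coeFn_add _ _).trans (h1.add h3), fun i => ?_⟩
  rw [pderiv_add i hφ.smooth hψ.smooth]
  exact (Lp.coeFn_add _ _).trans ((h2 i).add (h4 i))

/-! ### Averages of translated and dilated functions -/

theorem abs_integral_mul_le {α : Type*} [MeasurableSpace α] {μ : Measure α} {a g : α → ℝ}
    (ha : MemLp a 2 μ) (hg : MemLp g 2 μ) :
    |∫ x, a x * g x ∂μ| ≤ (eLpNorm a 2 μ).toReal * (eLpNorm g 2 μ).toReal := by
  have h := abs_real_inner_le_norm (ha.toLp a) (hg.toLp g)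
  rw [Lp.norm_toLp, Lp.norm_toLp, L2.inner_def] at h
  convert h using 2
  refine integral_congr_ae ?_
  filter_upwards [ha.coeFn_toLp, hg.coeFn_toLp] with x h1 h2
  simp [h1, h2, mul_comm]

/-- The dilation multiplies the pushed-forward volume by `l^{-d} ≤ 1`. Composition with `x ↦ l x -
c` is therefore a contraction of `L²`, uniformly in `l ≥ 1` and `c`. -/
theorem map_smul_sub_le {l : ℝ} (hl : 1 ≤ l) (c : E d) :
    Measure.map (fun x : E d => l • x - c) volume ≤ volume := by
  have h0 : (fun x : E d => l • x - c) = (fun x => x - c) ∘ fun x => l • x := rfl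
  rw [h0, ← Measure.map_map (by fun_prop) (by fun_prop),
    Measure.map_addHaar_smul volume (by positivity), Measure.map_smul,
    (measurePreserving_sub_right volume c).map_eq]
  intro s
  rw [Measure.smul_apply, smul_eq_mul]
  refine mul_le_of_le_one_left' ?_
  rw [ENNReal.ofReal_le_one, abs_of_nonneg (by positivity)]
  exact inv_le_one_of_one_le₀ (one_le_pow₀ hl)

theorem memLp_comp_smul_sub {l : ℝ} (hl : 1 ≤ l) (c : E d) {g : E d → ℝ}
    (hg : MemLp g 2 volume) : MemLp (fun x => g (l • x - c)) 2 volume :=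
  (hg.mono_measure (map_smul_sub_le hl c)).comp_of_map (by fun_prop)

theorem eLpNorm_comp_smul_sub_le {l : ℝ} (hl : 1 ≤ l) (c : E d) {g : E d → ℝ}
    (hg : MemLp g 2 volume) :
    eLpNorm (fun x => g (l • x - c)) 2 volume ≤ eLpNorm g 2 volume := by
  have h := eLpNorm_map_measure (p := 2)
    (hg.mono_measure (map_smul_sub_le hl c)).aestronglyMeasurable
    (f := fun x : E d => l • x - c) (by fun_prop)
  change eLpNorm (g ∘ fun x => l • x - c) 2 volume ≤ _
  rw [← h]
  exact eLpNorm_mono_measure _ (map_smul_sub_le hl c)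

/-- For continuous compactly supported `z` this is dominated convergence; the uniform `L²`
contraction extends it to all of `L²` by density. The filter is left general because the limit is
needed jointly in the dilation and the shift. -/
theorem tendsto_integral_mul_comp {a z : E d → ℝ} (ha : MemLp a 2 volume) (ha1 : Integrable a)
    (hz : MemLp z 2 volume) {κ : Type*} {L : Filter κ} [L.IsCountablyGenerated]
    {l : κ → ℝ} {c : κ → E d} (hl1 : ∀ n, 1 ≤ l n)
    (hl : Tendsto l L (𝓝 1)) (hc : Tendsto c L (𝓝 0)) :
    Tendsto (fun n => ∫ x, a x * z (l n • x - c n)) L (𝓝 (∫ x, a x * z x)) := by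
  rw [Metric.tendsto_nhds]
  intro ε hε
  set C := (eLpNorm a 2 volume).toReal with hC
  have hC0 : 0 ≤ C := ENNReal.toReal_nonneg
  -- Each of the three errors gets `ε / 3`; the `+ 1` covers the case `C = 0`.
  set η : ℝ := ε / (3 * (C + 1)) with hη
  have hη0 : 0 < η := by positivity
  obtain ⟨z', hz'c, hzz, hz'cont, hz'⟩ := hz.exists_hasCompactSupport_eLpNorm_sub_le (by simp)
    (ε := ENNReal.ofReal η) (by simpa using hη0)
  have hw : MemLp (z - z') 2 volume := hz.sub hz'
  have hwn : (eLpNorm (z - z') 2 volume).toReal ≤ η :=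
    ENNReal.toReal_le_of_le_ofReal hη0.le hzz
  have hsmall : C * η < ε / 3 := by
    rw [hη, mul_div_assoc', div_lt_div_iff₀ (by positivity) (by norm_num)]
    nlinarith
  have h1 : ∀ n, |(∫ x, a x * z (l n • x - c n)) - ∫ x, a x * z' (l n • x - c n)| ≤ C * η := by
    intro n
    have hm := memLp_comp_smul_sub (hl1 n) (c n) hw
    have e : (∫ x, a x * z (l n • x - c n)) - (∫ x, a x * z' (l n • x - c n)) =
        ∫ x, a x * (z - z') (l n • x - c n) := by
      rw [← integral_sub]
      · exact integral_congr_ae (ae_of_all _ fun x => by simp; ring)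
      · exact ha.integrable_mul (memLp_comp_smul_sub (hl1 n) (c n) hz)
      · exact ha.integrable_mul (memLp_comp_smul_sub (hl1 n) (c n) hz')
    rw [e]
    refine (abs_integral_mul_le ha hm).trans (mul_le_mul_of_nonneg_left ?_ hC0)
    exact (ENNReal.toReal_mono hw.eLpNorm_ne_top
      (eLpNorm_comp_smul_sub_le (hl1 n) (c n) hw)).trans hwn
  have h2 : |(∫ x, a x * z x) - ∫ x, a x * z' x| ≤ C * η := by
    have e : (∫ x, a x * z x) - (∫ x, a x * z' x) = ∫ x, a x * (z - z') x := by
      rw [← integral_sub]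
      rotate_left
      · exact ha.integrable_mul hz
      · exact ha.integrable_mul hz'
      exact integral_congr_ae (ae_of_all _ fun x => by simp; ring)
    rw [e]
    exact (abs_integral_mul_le ha hw).trans (mul_le_mul_of_nonneg_left hwn hC0)
  have h3 : Tendsto (fun n => ∫ x, a x * z' (l n • x - c n)) L (𝓝 (∫ x, a x * z' x)) := by
    obtain ⟨B, hB⟩ := hz'cont.bounded_above_of_compact_support hz'c
    refine tendsto_integral_filter_of_dominated_convergence (fun x => |a x| * B)
      (Eventually.of_forall fun n => ha1.aestronglyMeasurable.mul
        (hz'cont.comp (by fun_prop)).aestronglyMeasurable)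
      (Eventually.of_forall fun n => ae_of_all _ fun x => ?_) (ha1.abs.mul_const B)
      (ae_of_all _ fun x => ?_)
    · rw [norm_mul, Real.norm_eq_abs]
      exact mul_le_mul_of_nonneg_left (hB _) (abs_nonneg _)
    · refine tendsto_const_nhds.mul ((hz'cont.tendsto x).comp ?_)
      simpa using (hl.smul_const x).sub hc
  filter_upwards [(Metric.tendsto_nhds.1 h3) (ε / 3) (by positivity)] with n hn
  rw [Real.dist_eq] at hn ⊢
  have := h1 n
  rw [abs_lt] at hn ⊢
  rw [abs_le] at this h2
  constructor <;> linarith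

theorem integrable_kernel {a z η : E d → ℝ} (ha : Integrable a) (hz : Integrable z)
    (hη : Continuous η) (hηc : HasCompactSupport η) (l : ℝ) :
    Integrable (fun p : E d × E d => a p.1 * (z p.2 * η (l • p.1 - p.2)))
      (volume.prod volume) := by
  obtain ⟨B, hB⟩ := hη.bounded_above_of_compact_support hηc
  have h := (ha.mul_prod hz).mul_bdd (g := fun p : E d × E d => η (l • p.1 - p.2)) (c := B)
    (hη.comp (by fun_prop)).aestronglyMeasurable (ae_of_all _ fun p => hB _)
  simpa only [mul_assoc] using h

/-- Fubini's theorem for `∫∫ a(x) z(w) η(l x - w) dw dx` in the variables `x` and `c = l x - w`. -/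
theorem integral_kernel_eq {a z η : E d → ℝ} (ha : Integrable a) (hz : Integrable z)
    (hη : Continuous η) (hηc : HasCompactSupport η) (l : ℝ) :
    Integrable (fun c => η c * ∫ x, a x * z (l • x - c)) ∧
    ∫ x, a x * ∫ w, z w * η (l • x - w) = ∫ c, η c * ∫ x, a x * z (l • x - c) := by
  -- For fixed `x`, the substitution `w ↦ l x - w` is a reflection followed by a translation.
  have hmp : MeasurePreserving (fun p : E d × E d => (p.1, l • p.1 - p.2))
      (volume.prod volume) (volume.prod volume) :=
    (MeasurePreserving.id volume).skew_product (g := fun x c => l • x - c) (by fun_prop)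
      (ae_of_all _ fun x => (Measure.measurePreserving_sub_left volume (l • x)).map_eq)
  have h1 := integrable_kernel ha hz hη hηc l
  have h2 := hmp.integrable_comp_of_integrable h1
  have e : ((fun p : E d × E d => a p.1 * (z p.2 * η (l • p.1 - p.2))) ∘
      fun p : E d × E d => (p.1, l • p.1 - p.2)) =
      fun p => η p.2 * (a p.1 * z (l • p.1 - p.2)) := by
    funext p
    simp only [Function.comp, sub_sub_cancel]
    ring
  rw [e] at h2
  constructor
  · simpa only [integral_const_mul] using h2.integral_prod_right
  · have h3 := integral_integral_swap (f := fun x c => η c * (a x * z (l • x - c))) h2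
    simp only [integral_const_mul] at h3
    rw [← h3]
    refine integral_congr_ae (ae_of_all _ fun x => ?_)
    simp only
    rw [← integral_const_mul, ← integral_sub_left_eq_self _ _ (l • x)]
    refine integral_congr_ae (ae_of_all _ fun c => ?_)
    simp only [sub_sub_cancel]
    ring

/-- By Fubini the integral is the `η n`-weighted mean of the shifted pairings `∫ a(x) z(l x - c)
dx`, and the weight has mass one near `c = 0`. This gives weak convergence of the averages, which is
all that is needed later. -/
theorem tendsto_integral_mul_average {a z : E d → ℝ} (ha : MemLp a 2 volume) (ha1 : Integrable a)
    (hz : MemLp z 2 volume) (hz1 : Integrable z) {l δ : ℕ → ℝ} {η : ℕ → E d → ℝ}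
    (hl1 : ∀ n, 1 ≤ l n) (hl : Tendsto l atTop (𝓝 1)) (hδ : Tendsto δ atTop (𝓝 0))
    (hη : ∀ n, Continuous (η n)) (hηc : ∀ n, HasCompactSupport (η n)) (hη0 : ∀ n x, 0 ≤ η n x)
    (hηi : ∀ n, ∫ x, η n x = 1) (hηs : ∀ n x, η n x ≠ 0 → ‖x‖ ≤ δ n) :
    Tendsto (fun n => ∫ x, a x * ∫ w, z w * η n (l n • x - w)) atTop (𝓝 (∫ x, a x * z x)) := by
  set I := ∫ x, a x * z x
  -- A joint limit in `(l, c)` yields one neighbourhood that works for every `c` in the support of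
  -- `η n`. The factor `Set.Ici 1` carries the bound `1 ≤ l`.
  have key : Tendsto (fun p : Set.Ici (1 : ℝ) × E d => ∫ x, a x * z (p.1.1 • x - p.2))
      (𝓝 ((⟨1, Set.self_mem_Ici⟩ : Set.Ici (1 : ℝ)), (0 : E d))) (𝓝 I) :=
    tendsto_integral_mul_comp ha ha1 hz (fun p => p.1.2)
      ((continuous_subtype_val.comp continuous_fst).tendsto ((⟨1, Set.self_mem_Ici⟩ : Set.Ici (1 : ℝ)), (0 : E d)))
      (continuous_snd.tendsto ((⟨1, Set.self_mem_Ici⟩ : Set.Ici (1 : ℝ)), (0 : E d)))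
  rw [Metric.tendsto_atTop]
  intro ε hε
  obtain ⟨r, hr, hr'⟩ := Metric.eventually_nhds_iff.1 (Metric.tendsto_nhds.1 key (ε / 2)
    (half_pos hε))
  obtain ⟨N1, hN1⟩ := Metric.tendsto_atTop.1 hl r hr
  obtain ⟨N2, hN2⟩ := Metric.tendsto_atTop.1 hδ r hr
  refine ⟨max N1 N2, fun n hn => ?_⟩
  have h1 := hN1 n (le_of_max_le_left hn)
  have h2 := hN2 n (le_of_max_le_right hn)
  obtain ⟨hint, heq⟩ := integral_kernel_eq ha1 hz1 (hη n) (hηc n) (l n)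
  have hηint : Integrable (η n) := (hη n).integrable_of_hasCompactSupport (hηc n)
  have e : (∫ c, η n c * ∫ x, a x * z (l n • x - c)) - I =
      ∫ c, (η n c * (∫ x, a x * z (l n • x - c)) - η n c * I) := by
    rw [integral_sub hint (hηint.mul_const I), integral_mul_const, hηi, one_mul]
  rw [heq, dist_eq_norm, e]
  have hb : ∫ c, η n c * (ε / 2) = ε / 2 := by rw [integral_mul_const, hηi, one_mul]
  refine lt_of_le_of_lt ((norm_integral_le_of_norm_le (hηint.mul_const (ε / 2))
    (ae_of_all _ fun c => ?_)).trans hb.le) (half_lt_self hε)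
  rw [← mul_sub, norm_mul, Real.norm_of_nonneg (hη0 n c)]
  by_cases hc : η n c = 0
  · simp [hc]
  refine mul_le_mul_of_nonneg_left ?_ (hη0 n c)
  have := hr' (y := (⟨l n, hl1 n⟩, c)) (by
    rw [Prod.dist_eq, max_lt_iff]
    refine ⟨h1, ?_⟩
    rw [dist_zero_right]
    refine (hηs n c hc).trans_lt ?_
    rw [Real.dist_eq, sub_zero] at h2
    exact (le_abs_self _).trans_lt h2)
  exact (dist_eq_norm (_ : ℝ) I ▸ this).le

/-! ### The closure of the test functions in `H²` -/

/-- The pairs `(φ, D²φ)` with `φ ∈ C_c^∞(S)`. -/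
def testGraph (S : Set (E d)) : Submodule ℝ (WithLp 2 (L2 S × L2mat S)) where
  carrier := {p | ∃ φ : E d → ℝ, IsTestFunction S φ ∧ p.fst =ᵐ[volume.restrict S] φ ∧
    ∀ i j, p.snd (i, j) =ᵐ[volume.restrict S] pderiv i (pderiv j φ)}
  zero_mem' := by
    have h0 : ∀ j : Fin d, pderiv j (0 : E d → ℝ) = 0 := fun j => by
      funext y; simp [pderiv]
    refine ⟨0, IsTestFunction.zero, Lp.coeFn_zero _ _ _, fun i j => ?_⟩
    rw [h0, h0]
    exact Lp.coeFn_zero _ _ _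
  add_mem' := by
    rintro p q ⟨φ, hφ, h1, h2⟩ ⟨ψ, hψ, h3, h4⟩
    refine ⟨φ + ψ, hφ.add hψ, (Lp.coeFn_add _ _).trans (h1.add h3), fun i j => ?_⟩
    rw [pderiv_add j hφ.smooth hψ.smooth,
      pderiv_add i (hφ.pderiv j).smooth (hψ.pderiv j).smooth]
    exact (Lp.coeFn_add _ _).trans ((h2 i j).add (h4 i j))
  smul_mem' := by
    rintro c p ⟨φ, hφ, h1, h2⟩
    refine ⟨c • φ, hφ.smul c, (Lp.coeFn_smul _ _).trans (h1.const_smul c), fun i j => ?_⟩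
    rw [pderiv_smul j c hφ.smooth, pderiv_smul i c (hφ.pderiv j).smooth]
    exact (Lp.coeFn_smul _ _).trans ((h2 i j).const_smul c)

theorem HasWeakPartial.of_tendsto {S : Set (E d)} {i : Fin d} {u g : ℕ → L2 S} {u' g' : L2 S}
    (h : ∀ n, HasWeakPartial S i (u n) (g n)) (hu : Tendsto u atTop (𝓝 u'))
    (hg : Tendsto g atTop (𝓝 g')) : HasWeakPartial S i u' g' := by
  intro φ hφ
  have key : ∀ (v : L2 S) (ψ : E d → ℝ) (hψ : IsTestFunction S ψ),
      ∫ x in S, v x * ψ x = inner ℝ v ((hψ.memLp 2 (volume.restrict S)).toLp ψ) :=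
    fun v ψ hψ => (inner_L2_of_ae _ _ (MemLp.coeFn_toLp _)).symm
  rw [key _ _ (hφ.pderiv i), key _ _ hφ]
  refine tendsto_nhds_unique (hu.inner tendsto_const_nhds) ?_
  refine ((hg.inner tendsto_const_nhds).neg).congr fun n => ?_
  rw [← key _ _ hφ, ← key _ _ (hφ.pderiv i), h n φ hφ]

theorem hasWeakPartial_of_test {S : Set (E d)} (i : Fin d) {φ : E d → ℝ}
    (hφ : IsTestFunction S φ) {u g : L2 S} (hu : u =ᵐ[volume.restrict S] φ)
    (hg : g =ᵐ[volume.restrict S] pderiv i φ) : HasWeakPartial S i u g := by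
  intro ψ hψ
  have e1 : ∫ x in S, u x * pderiv i ψ x = ∫ x, φ x * pderiv i ψ x := by
    rw [← setIntegral_eq_integral_of_forall_compl_eq_zero
      (f := fun x => φ x * pderiv i ψ x) (s := S) fun x hx => by
        rw [hφ.eq_zero_of_notMem hx, zero_mul]]
    exact integral_congr_ae (hu.mono fun x hx => by simp [hx])
  have e2 : ∫ x in S, g x * ψ x = ∫ x, pderiv i φ x * ψ x := by
    rw [← setIntegral_eq_integral_of_forall_compl_eq_zero
      (f := fun x => pderiv i φ x * ψ x) (s := S) fun x hx => by
        rw [(hφ.pderiv i).eq_zero_of_notMem hx, zero_mul]]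
    exact integral_congr_ae (hg.mono fun x hx => by simp [hx])
  rw [e1, e2, integral_mul_pderiv i hφ.smooth hψ.smooth hφ.compact]

/-- Integration by parts gives `‖∂_i φ‖² = -(φ, ∂_i ∂_i φ)`, and Cauchy–Schwarz bounds this by the
graph norm squared. The gradient thus need not be recorded in `testGraph`. -/
theorem norm_gradient_le {S : Set (E d)} {p : WithLp 2 (L2 S × L2mat S)} {φ : E d → ℝ}
    (hφ : IsTestFunction S φ) (h1 : p.fst =ᵐ[volume.restrict S] φ)
    (h2 : ∀ i j, p.snd (i, j) =ᵐ[volume.restrict S] pderiv i (pderiv j φ)) (i : Fin d)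
    {g : L2 S} (hg : g =ᵐ[volume.restrict S] pderiv i φ) : ‖g‖ ≤ ‖p‖ := by
  have e : ‖g‖ ^ 2 = -inner ℝ p.fst (p.snd (i, i)) := by
    rw [← real_inner_self_eq_norm_sq, inner_L2_of_ae _ _ hg, inner_L2_of_ae _ _ (h2 i i),
      hasWeakPartial_of_test i hφ h1 hg _ (hφ.pderiv i), neg_neg]
  have h3 : ‖g‖ ^ 2 ≤ ‖p‖ * ‖p‖ := by
    rw [e]
    refine (neg_le_abs _).trans ((abs_real_inner_le_norm _ _).trans ?_)
    exact mul_le_mul (WithLp.norm_fst_le _ p)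
      ((PiLp.norm_apply_le p.snd (i, i)).trans (WithLp.norm_snd_le _ p)) (norm_nonneg _)
      (norm_nonneg _)
  nlinarith [norm_nonneg g, norm_nonneg p]

/-- Along an approximating sequence the gradients are Cauchy by `norm_gradient_le`. Their limit
witnesses membership in `H10` and is the intermediate gradient of the weak Hessian. -/
theorem mem_X_of_mem_closure {S : Set (E d)} {p : WithLp 2 (L2 S × L2mat S)}
    (hp : p ∈ (testGraph S).topologicalClosure) :
    p.fst ∈ H10 S ∧ IsWeakHessian S p.fst p.snd := by
  obtain ⟨q, hq, hqp⟩ := mem_closure_iff_seq_limit.1 hp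
  choose φ hφ h1 h2 using hq
  let g : Fin d → ℕ → L2 S := fun i n => (((hφ n).pderiv i).memLp 2 (volume.restrict S)).toLp _
  have hg : ∀ i n, g i n =ᵐ[volume.restrict S] pderiv i (φ n) := fun i n => MemLp.coeFn_toLp _
  have hdist : ∀ i n m, dist (g i n) (g i m) ≤ dist (q n) (q m) := by
    intro i n m
    rw [dist_eq_norm, dist_eq_norm]
    have ht : IsTestFunction S (φ n - φ m) := by
      have := (hφ n).add ((hφ m).smul (-1))
      rwa [neg_one_smul, ← sub_eq_add_neg] at this
    refine norm_gradient_le (p := q n - q m) ht ((Lp.coeFn_sub _ _).trans ((h1 n).sub (h1 m)))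
      (fun k l => ?_) i ?_
    · rw [pderiv_sub l (hφ n).smooth (hφ m).smooth,
        pderiv_sub k ((hφ n).pderiv l).smooth ((hφ m).pderiv l).smooth]
      exact (Lp.coeFn_sub _ _).trans ((h2 n k l).sub (h2 m k l))
    · rw [pderiv_sub i (hφ n).smooth (hφ m).smooth]
      exact (Lp.coeFn_sub _ _).trans ((hg i n).sub (hg i m))
  have hcau : ∀ i, CauchySeq (g i) := fun i => by
    have hc := hqp.cauchySeq
    rw [Metric.cauchySeq_iff] at hc ⊢
    intro ε hε
    obtain ⟨N, hN⟩ := hc ε hε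
    exact ⟨N, fun n hn m hm => (hdist i n m).trans_lt (hN n hn m hm)⟩
  choose G hG using fun i => cauchySeq_tendsto_of_complete (hcau i)
  have hz : Tendsto (fun n => (q n).fst) atTop (𝓝 p.fst) :=
    ((WithLp.fstL 2 ℝ (L2 S) (L2mat S)).continuous.tendsto p).comp hqp
  have hN : ∀ k, Tendsto (fun n => (q n).snd k) atTop (𝓝 (p.snd k)) := fun k =>
    (((PiLp.proj 2 (𝕜 := ℝ) (fun _ : Fin d × Fin d => L2 S) k).comp
      (WithLp.sndL 2 ℝ (L2 S) (L2mat S))).continuous.tendsto p).comp hqp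
  refine ⟨⟨WithLp.toLp 2 G, mem_closure_of_tendsto (f := fun n => ((q n).fst,
    (WithLp.toLp 2 fun i => g i n : L2vec S))) (b := atTop) ?_ (Eventually.of_forall fun n =>
      ⟨φ n, hφ n, h1 n, fun i => hg i n⟩)⟩, WithLp.toLp 2 G, fun i => ?_, fun i j => ?_⟩
  · refine hz.prodMk_nhds ?_
    exact ((PiLp.continuous_toLp 2 (fun _ : Fin d => L2 S)).tendsto G).comp (tendsto_pi_nhds.2 hG)
  · exact HasWeakPartial.of_tendsto (fun n => hasWeakPartial_of_test i (hφ n) (h1 n) (hg i n)) hz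
      (hG i)
  · refine HasWeakPartial.of_tendsto (fun n => hasWeakPartial_of_test j ((hφ n).pderiv i) (hg i n)
      ?_) (hG i) (hN (i, j))
    rw [pderiv_comm j i (hφ n).smooth]
    exact h2 n i j

/-! ### Dilated averages as test functions -/

/-- The average is the convolution of `z` and `η` composed with `x ↦ l x`: the derivative falls on
`η`, and the chain rule contributes `l`. -/
theorem pderiv_average {z η : E d → ℝ} (hz : Integrable z) (hη : ContDiff ℝ ∞ η)
    (hηc : HasCompactSupport η) (l : ℝ) :
    ContDiff ℝ ∞ (fun x => ∫ w, z w * η (l • x - w)) ∧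
    ∀ i, pderiv i (fun x => ∫ w, z w * η (l • x - w)) =
      l • fun x => ∫ w, z w * pderiv i η (l • x - w) := by
  have hcd : ContDiff ℝ ∞ (convolution z η (ContinuousLinearMap.mul ℝ ℝ) volume) :=
    hηc.contDiff_convolution_right _ hz.locallyIntegrable hη
  refine ⟨hcd.comp (contDiff_const_smul l), fun i => ?_⟩
  funext x
  have h := hηc.hasFDerivAt_convolution_right (ContinuousLinearMap.mul ℝ ℝ) hz.locallyIntegrable
    (hη.of_le (by exact_mod_cast le_top)) (l • x)
  have h2 : HasFDerivAt (fun y : E d => l • y) (l • ContinuousLinearMap.id ℝ (E d)) x :=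
    (hasFDerivAt_id x).const_smul l
  have h3 := (h.comp x h2).fderiv
  change fderiv ℝ (convolution z η (ContinuousLinearMap.mul ℝ ℝ) volume ∘ fun y : E d => l • y) x
    _ = _
  rw [h3]
  simp only [ContinuousLinearMap.comp_apply, _root_.smul_apply, map_smul,
    ContinuousLinearMap.id_apply]
  rw [convolution_precompR_apply _ hz.locallyIntegrable (hηc.fderiv ℝ)
    (hη.continuous_fderiv (by simp))]
  rfl

theorem pderiv_comp_sub (i : Fin d) {η : E d → ℝ} (hη : ContDiff ℝ ∞ η) (y : E d) :
    pderiv i (fun w => η (y - w)) = -fun w => pderiv i η (y - w) := by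
  funext w
  have h := (hη.differentiable (by simp) (y - w)).hasFDerivAt
  have h2 : HasFDerivAt (fun w : E d => y - w) (-ContinuousLinearMap.id ℝ (E d)) w :=
    (hasFDerivAt_id w).const_sub y
  have h3 := (h.comp w h2).fderiv
  change fderiv ℝ (η ∘ fun w => y - w) w _ = _
  rw [h3]
  simp [Ultraweak.pderiv]

theorem isTestFunction_comp_sub {η : E d → ℝ} (hη : ContDiff ℝ ∞ η) (hc : HasCompactSupport η)
    (y : E d) : IsTestFunction Set.univ (fun w => η (y - w)) :=
  ⟨hη.comp (contDiff_const.sub contDiff_id), hc.comp_homeomorph (Homeomorph.subLeft y),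
    Set.subset_univ _⟩

/-- Dilating a convex set about an interior point leaves room for averaging. -/
theorem isTestFunction_average {Ω : Set (E d)} (hΩo : IsOpen Ω) (hΩ : Convex ℝ Ω)
    (hb : Bornology.IsBounded Ω) {x₀ : E d} {r : ℝ} (hr : Metric.closedBall x₀ r ⊆ Ω)
    {z η : E d → ℝ} (hz : Integrable z) (hzΩ : ∀ x ∉ Ω, z x = 0) (hη : ContDiff ℝ ∞ η)
    (hηc : HasCompactSupport η) {l : ℝ} (hl : 1 < l)
    (hηs : ∀ x, η x ≠ 0 → ‖x - (l - 1) • x₀‖ ≤ (l - 1) * r) :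
    IsTestFunction Ω (fun x => ∫ w, z w * η (l • x - w)) := by
  have hl0 : 0 < l := by linarith
  -- If the integrand is nonzero at `w`, then `x = l⁻¹ w + (1 - l⁻¹) y` with `y = (l x - w) / (l -
  -- 1)`. Here `w ∈ Ω`, and the support condition on `η` places `y` in the ball about `x₀`.
  set K : Set (E d) := (l⁻¹ : ℝ) • closure Ω + (1 - l⁻¹ : ℝ) • Metric.closedBall x₀ r with hK
  have hl' : 0 < 1 - l⁻¹ := by
    have := inv_lt_one_of_one_lt₀ hl
    linarith
  have hKc : IsCompact K :=
    (hb.isCompact_closure.smul _).add ((isCompact_closedBall x₀ r).smul _)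
  -- A proper convex combination of a closure point and an interior point is interior.
  have hKΩ : K ⊆ Ω := by
    have h := hΩ.combo_closure_interior_subset_interior (a := l⁻¹) (b := 1 - l⁻¹)
      (by positivity) hl' (by ring)
    rw [hΩo.interior_eq] at h
    exact (Set.add_subset_add_left (Set.smul_set_mono hr)).trans h
  have hs : Function.support (fun x => ∫ w, z w * η (l • x - w)) ⊆ K := by
    intro x hx
    have : ∃ w, z w * η (l • x - w) ≠ 0 := by
      by_contra! h
      exact hx (by simp [h])
    obtain ⟨w, hw⟩ := this
    have hw1 : w ∈ Ω := by
      by_contra h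
      exact hw (by rw [hzΩ w h, zero_mul])
    have hw2 := hηs _ (right_ne_zero_of_mul hw)
    refine Set.mem_add.2 ⟨l⁻¹ • w, Set.smul_mem_smul_set (subset_closure hw1),
      (1 - l⁻¹) • ((l - 1)⁻¹ • (l • x - w)), Set.smul_mem_smul_set ?_, ?_⟩
    · have hl1 : 0 < l - 1 := by linarith
      rw [mem_closedBall_iff_norm]
      have e : (l - 1)⁻¹ • (l • x - w) - x₀ = (l - 1)⁻¹ • (l • x - w - (l - 1) • x₀) := by
        rw [smul_sub _ _ ((l - 1) • x₀), smul_smul, inv_mul_cancel₀ hl1.ne', one_smul]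
      rw [e, norm_smul, Real.norm_of_nonneg (by positivity), inv_mul_le_iff₀ hl1]
      exact hw2
    · have hl1 : l - 1 ≠ 0 := by linarith
      have e : (1 - l⁻¹) * (l - 1)⁻¹ = l⁻¹ := by field_simp
      rw [smul_smul, e, smul_sub, smul_smul, inv_mul_cancel₀ hl0.ne', one_smul]
      abel
  have ht := closure_minimal hs hKc.isClosed
  exact ⟨(pderiv_average hz hη hηc l).1, HasCompactSupport.of_support_subset_isCompact hKc hs,
    ht.trans hKΩ⟩

/-! ### Extension by zero -/

theorem memLp_extend {Ω : Set (E d)} (hΩ : MeasurableSet Ω) (u : L2 Ω) :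
    MemLp (Ω.indicator u) 2 volume :=
  (memLp_indicator_iff_restrict hΩ).2 (Lp.memLp u)

theorem integrable_extend {Ω : Set (E d)} (hΩ : MeasurableSet Ω) (hb : Bornology.IsBounded Ω)
    (u : L2 Ω) : Integrable (Ω.indicator u) := by
  have : Fact (volume Ω < ⊤) := ⟨hb.measure_lt_top⟩
  rw [integrable_indicator_iff hΩ]
  exact (Lp.memLp u).integrable (by norm_num)

theorem setIntegral_mul_eq {Ω : Set (E d)} (hΩ : MeasurableSet Ω) (u ψ : E d → ℝ) :
    ∫ x in Ω, u x * ψ x = ∫ x, Ω.indicator u x * ψ x := by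
  rw [← integral_indicator hΩ]
  exact integral_congr_ae (ae_of_all _ fun x => Set.indicator_mul_left _ _ _)

/-- If the extension by zero of `z` has the extension by zero of `N` as distributional Hessian on
the whole space, then `(z, N)` is a limit of pairs `(φ, D²φ)` with `φ ∈ C_c^∞(Ω)`. -/
theorem mem_closure_testGraph {Ω : Set (E d)} (hΩo : IsOpen Ω) (hΩ : Convex ℝ Ω)
    (hb : Bornology.IsBounded Ω) (hne : Ω.Nonempty) {p : WithLp 2 (L2 Ω × L2mat Ω)}
    (hp : ∀ φ, IsTestFunction Set.univ φ → ∀ i j,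
      ∫ x in Ω, p.fst x * pderiv i (pderiv j φ) x = ∫ x in Ω, p.snd (i, j) x * φ x) :
    p ∈ (testGraph Ω).topologicalClosure := by
  have hm := hΩo.measurableSet
  -- Passing to the double orthogonal complement reduces the claim to weak convergence, tested
  -- against one fixed `a`.
  rw [← Submodule.orthogonal_orthogonal_eq_closure, Submodule.mem_orthogonal]
  intro a ha
  obtain ⟨x₀, hx₀⟩ := hne
  obtain ⟨r, hr, hball⟩ := Metric.isOpen_iff.1 hΩo x₀ hx₀
  have hcball : Metric.closedBall x₀ (r / 2) ⊆ Ω :=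
    (Metric.closedBall_subset_ball (half_lt_self hr)).trans hball
  let l : ℕ → ℝ := fun n => 1 + 1 / ((n : ℝ) + 1)
  have hl : ∀ n, 1 < l n := fun n => by
    have : (0 : ℝ) < 1 / ((n : ℝ) + 1) := by positivity
    simp only [l]; linarith
  have hl1 : Tendsto l atTop (𝓝 1) := by
    simpa [l] using tendsto_const_nhds.add (tendsto_one_div_add_atTop_nhds_zero_nat (𝕜 := ℝ))
  have hpos : ∀ n, 0 < (l n - 1) * (r / 2) := fun n =>
    mul_pos (by linarith [hl n]) (half_pos hr)
  -- Centre and radius are those demanded by `isTestFunction_average`: dilating by `l` about the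
  -- origin instead of `x₀` costs the shift `(l - 1) x₀`.
  let B : (n : ℕ) → ContDiffBump ((l n - 1) • x₀) := fun n =>
    ⟨(l n - 1) * (r / 2) / 2, (l n - 1) * (r / 2), half_pos (hpos n), half_lt_self (hpos n)⟩
  let η : ℕ → E d → ℝ := fun n => (B n).normed volume
  have hη : ∀ n, ContDiff ℝ ∞ (η n) := fun n => (B n).contDiff_normed
  have hηc : ∀ n, HasCompactSupport (η n) := fun n => (B n).hasCompactSupport_normed
  have hηs : ∀ n x, η n x ≠ 0 → ‖x - (l n - 1) • x₀‖ ≤ (l n - 1) * (r / 2) := fun n x hx => by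
    have hx' : x ∈ Function.support ((B n).normed volume) := hx
    rw [(B n).support_normed_eq] at hx'
    exact (mem_ball_iff_norm.1 hx').le
  let δ : ℕ → ℝ := fun n => (l n - 1) * (r / 2) + (l n - 1) * ‖x₀‖
  have hδ : Tendsto δ atTop (𝓝 0) := by
    have h0 : Tendsto (fun n => l n - 1) atTop (𝓝 0) := by simpa using hl1.sub_const 1
    simpa [δ] using (h0.mul_const (r / 2)).add (h0.mul_const ‖x₀‖)
  have hηδ : ∀ n x, η n x ≠ 0 → ‖x‖ ≤ δ n := fun n x hx => by
    have h1 := hηs n x hx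
    have h2 := norm_le_norm_sub_add x ((l n - 1) • x₀)
    rw [norm_smul, Real.norm_of_nonneg (by linarith [hl n])] at h2
    simp only [δ]; linarith
  have hlim : ∀ u v : L2 Ω, Tendsto (fun n => ∫ x, Ω.indicator u x *
      ∫ w, Ω.indicator v w * η n (l n • x - w)) atTop (𝓝 (inner ℝ u v)) := by
    intro u v
    have h := tendsto_integral_mul_average (memLp_extend hm u) (integrable_extend hm hb u)
      (memLp_extend hm v) (integrable_extend hm hb v) (fun n => (hl n).le) hl1 hδ
      (fun n => (hη n).continuous) hηc (fun n => (B n).nonneg_normed)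
      (fun n => (B n).integral_normed) hηδ
    convert h using 2
    rw [inner_L2, setIntegral_mul_eq hm]
    exact integral_congr_ae (ae_of_all _ fun x => by
      by_cases hx : x ∈ Ω <;> simp [hx])
  let φ : ℕ → E d → ℝ := fun n x => ∫ w, Ω.indicator p.fst w * η n (l n • x - w)
  have hφ : ∀ n, IsTestFunction Ω (φ n) := fun n =>
    isTestFunction_average hΩo hΩ hb hcball (integrable_extend hm hb _)
      (fun x hx => Set.indicator_of_notMem hx _) (hη n) (hηc n) (hl n) (hηs n)
  have hdd : ∀ n i j, pderiv i (pderiv j (φ n)) =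
      l n ^ 2 • fun x => ∫ w, Ω.indicator (p.snd (i, j)) w * η n (l n • x - w) := by
    intro n i j
    have hz := integrable_extend hm hb p.fst
    have h1 := pderiv_average hz (pderiv_contDiff j (hη n)) (hasCompactSupport_pderiv j (hηc n))
      (l n)
    rw [(pderiv_average hz (hη n) (hηc n) (l n)).2 j, pderiv_smul i _ h1.1, h1.2 i, smul_smul,
      ← sq]
    congr 1
    funext x
    -- For fixed `x` the kernel `w ↦ η(l x - w)` is a test function on the whole space, so `hp`
    -- trades its second derivatives for `p.snd`. The two signs from differentiating in `w` cancel.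
    rw [← setIntegral_mul_eq hm, ← setIntegral_mul_eq hm,
      ← hp _ (isTestFunction_comp_sub (hη n) (hηc n) (l n • x)) i j]
    refine integral_congr_ae (ae_of_all _ fun w => ?_)
    have e : pderiv i (pderiv j fun w => η n (l n • x - w)) =
        fun w => pderiv i (pderiv j (η n)) (l n • x - w) := by
      rw [pderiv_comp_sub j (hη n)]
      have e2 := pderiv_smul i (-1) (isTestFunction_comp_sub (pderiv_contDiff j (hη n))
        (hasCompactSupport_pderiv j (hηc n)) (l n • x)).smooth
      rw [neg_one_smul, neg_one_smul, pderiv_comp_sub i (pderiv_contDiff j (hη n)), neg_neg] at e2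
      exact e2
    simp only [e]
  -- Orthogonality of `a` to `(φ_n, D²φ_n)`; as `l n ^ 2 → 1`, the limit is orthogonality to `p`.
  have hzero : ∀ n, (∫ x, Ω.indicator a.fst x * φ n x) + ∑ k : Fin d × Fin d,
      l n ^ 2 * ∫ x, Ω.indicator (a.snd k) x *
        ∫ w, Ω.indicator (p.snd k) w * η n (l n • x - w) = 0 := by
    intro n
    let q : WithLp 2 (L2 Ω × L2mat Ω) := WithLp.toLp 2
      (((hφ n).memLp 2 (volume.restrict Ω)).toLp _, WithLp.toLp 2 fun k : Fin d × Fin d =>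
        ((((hφ n).pderiv k.2).pderiv k.1).memLp 2 (volume.restrict Ω)).toLp _)
    have hq1 : q.fst =ᵐ[volume.restrict Ω] φ n := ((hφ n).memLp 2 _).coeFn_toLp
    have hq2 : ∀ i j, q.snd (i, j) =ᵐ[volume.restrict Ω] pderiv i (pderiv j (φ n)) :=
      fun i j => ((((hφ n).pderiv j).pderiv i).memLp 2 _).coeFn_toLp
    have hq : q ∈ testGraph Ω := ⟨φ n, hφ n, hq1, hq2⟩
    have h0 := Submodule.inner_left_of_mem_orthogonal hq ha
    rw [WithLp.prod_inner_apply, PiLp.inner_apply] at h0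
    rw [← h0]
    congr 1
    · rw [← setIntegral_mul_eq hm]
      exact (inner_L2_of_ae _ q.fst hq1).symm
    · refine Finset.sum_congr rfl fun k _ => ?_
      refine Eq.trans ?_ (inner_L2_of_ae _ (q.snd k) (hq2 k.1 k.2)).symm
      rw [hdd n k.1 k.2, setIntegral_mul_eq hm, ← integral_const_mul]
      exact integral_congr_ae (ae_of_all _ fun x => by
        simp only [Pi.smul_apply, smul_eq_mul]; exact mul_left_comm _ _ _)
  have hsum := (hlim a.fst p.fst).add (tendsto_finsetSum Finset.univ fun k _ =>
    (hl1.pow 2).mul (hlim (a.snd k) (p.snd k)))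
  rw [WithLp.prod_inner_apply, PiLp.inner_apply]
  simp only [one_pow, one_mul] at hsum
  exact tendsto_nhds_unique (hsum.congr hzero) tendsto_const_nhds |>.trans rfl

/-! ### Meshes -/

/-- The boundary of a Lipschitz domain is a null set. -/
theorem IsLipschitzDomain.volume_frontier {T : Set (E d)} (hT : IsLipschitzDomain T) :
    volume (frontier T) = 0 := by
  refine measure_null_of_locally_null _ fun x hx => ?_
  obtain ⟨ν, r, K, h, hν, hr, hh, hTb⟩ := hT.boundary x hx
  have hνν : inner ℝ ν ν = (1 : ℝ) := by rw [real_inner_self_eq_norm_sq, hν, one_pow]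
  have hcont : Continuous fun y : E d => h (y - inner ℝ ν y • ν) :=
    hh.continuous.comp (by fun_prop)
  have hcont' : Continuous fun y : E d => (inner ℝ ν y : ℝ) := by fun_prop
  -- Near `x` the boundary lies on the graph of `h`: closure points satisfy `≤`, and points with `<`
  -- belong to the open set `T`.
  set G : Set (E d) := {y | h (y - inner ℝ ν y • ν) = inner ℝ ν y} with hG
  have hGc : IsClosed G := isClosed_eq hcont hcont'
  have hsub : frontier T ∩ Metric.ball x r ⊆ G := by
    rintro y ⟨hy, hyb⟩
    refine le_antisymm ?_ ?_
    · have h1 : y ∈ closure (T ∩ Metric.ball x r) :=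
        Metric.isOpen_ball.closure_inter ⟨frontier_subset_closure hy, hyb⟩
      rw [hTb] at h1
      have h2 : {y | h (y - inner ℝ ν y • ν) < inner ℝ ν y} ∩ Metric.ball x r ⊆
          {y | h (y - inner ℝ ν y • ν) ≤ inner ℝ ν y} := fun y hy => (Set.mem_ofPred.1 hy.1).le
      exact closure_minimal h2 (isClosed_le hcont hcont') h1
    · by_contra hlt
      have h1 : y ∈ T ∩ Metric.ball x r := hTb ▸ ⟨not_le.1 hlt, hyb⟩
      rw [hT.isOpen.frontier_eq] at hy
      exact hy.2 h1.1
  have hG0 : volume G = 0 := by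
    -- A shift along `ν` changes the height but not the projection, so distinct shifts of a graph
    -- are disjoint. Infinitely many of them by bounded amounts force measure zero.
    refine Measure.addHaar_eq_zero_of_disjoint_translates volume
      (fun n : ℕ => (1 / ((n : ℝ) + 1)) • ν) ?_ ?_ hGc.measurableSet
    · refine (Metric.isBounded_closedBall (x := (0 : E d)) (r := 1)).subset ?_
      rintro _ ⟨n, rfl⟩
      rw [mem_closedBall_zero_iff, norm_smul, hν, mul_one, Real.norm_of_nonneg (by positivity)]
      exact (div_le_one (by positivity)).2 (by linarith [(Nat.cast_nonneg n : (0 : ℝ) ≤ n)])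
    · intro n m hnm
      rw [Function.onFun, Set.disjoint_left]
      intro y hn hm
      rw [Set.singleton_add, Set.mem_image] at hn hm
      obtain ⟨g, hg, rfl⟩ := hn
      obtain ⟨g', hg', he⟩ := hm
      set s : ℝ := 1 / ((n : ℝ) + 1) with hs
      set t : ℝ := 1 / ((m : ℝ) + 1) with ht
      have hst : g' = g + (s - t) • ν := by
        rw [sub_smul, eq_comm]
        have he' : t • ν + g' = s • ν + g := he
        rw [← sub_eq_iff_eq_add'.2 he'.symm]
        abel
      have hin : (inner ℝ ν g' : ℝ) = inner ℝ ν g + (s - t) := by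
        rw [hst, inner_add_right, inner_smul_right, hνν, mul_one]
      have hproj : g' - (inner ℝ ν g' : ℝ) • ν = g - (inner ℝ ν g : ℝ) • ν := by
        rw [hin, hst]
        module
      have h1 : h (g' - (inner ℝ ν g' : ℝ) • ν) = inner ℝ ν g' := hg'
      have h2 : h (g - (inner ℝ ν g : ℝ) • ν) = inner ℝ ν g := hg
      rw [hproj, h2, hin] at h1
      have h3 : s = t := by linarith
      rw [hs, ht, one_div, one_div, inv_inj] at h3
      exact hnm (by exact_mod_cast add_right_cancel h3)
  exact ⟨frontier T ∩ Metric.ball x r, inter_mem_nhdsWithin _ (Metric.ball_mem_nhds x hr),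
    measure_mono_null hsub hG0⟩

/-- The points of `Ω` in no element lie on element boundaries, which are null. -/
theorem Mesh.iUnion_ae_eq {Ω : Set (E d)} {ι : Type*} [Fintype ι] (𝒯 : Mesh Ω ι) :
    (⋃ T, 𝒯.elem T : Set (E d)) =ᵐ[volume] Ω := by
  refine (Set.iUnion_subset 𝒯.subset).eventuallyLE.antisymm ?_
  rw [ae_le_set]
  refine measure_mono_null (t := ⋃ T, frontier (𝒯.elem T)) ?_
    (measure_iUnion_null fun T => (𝒯.lipschitz T).volume_frontier)
  rintro x ⟨hx, hx'⟩
  have h1 : x ∈ ⋃ T, closure (𝒯.elem T) := 𝒯.cover ▸ subset_closure hx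
  obtain ⟨T, hT⟩ := Set.mem_iUnion.1 h1
  refine Set.mem_iUnion.2 ⟨T, ?_⟩
  rw [(𝒯.lipschitz T).isOpen.frontier_eq]
  exact ⟨hT, fun h => hx' (Set.mem_iUnion.2 ⟨T, h⟩)⟩

theorem Mesh.sum_setIntegral {Ω : Set (E d)} {ι : Type*} [Fintype ι] (𝒯 : Mesh Ω ι)
    {g : E d → ℝ} (hg : IntegrableOn g Ω) : ∑ T, ∫ x in 𝒯.elem T, g x = ∫ x in Ω, g x := by
  rw [← setIntegral_congr_set 𝒯.iUnion_ae_eq]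
  exact (integral_iUnion_fintype (fun T => (𝒯.lipschitz T).isOpen.measurableSet) 𝒯.disjoint
    fun T => hg.mono_set (𝒯.subset T)).symm

/-! ### Elementwise pairings and the trace -/

section Pairings

variable {Ω : Set (E d)} {ι : Type*} [Fintype ι] (𝒯 : Mesh Ω ι)

/-- `∑_T (u, div Div Q)_T`. -/
def dDivPairing (u : L2 Ω) (Q : BrokenHdDiv 𝒯) : ℝ :=
  ∑ T, inner ℝ (restrictL2 (𝒯.subset T) u) (HdDiv.dDiv (Q T))

/-- `∑_T (N, Q)_T`. -/
def fieldPairing (N : L2mat Ω) (Q : BrokenHdDiv 𝒯) : ℝ :=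
  ∑ T, ∑ i, ∑ j, inner ℝ (restrictL2 (𝒯.subset T) (N (i, j))) (HdDiv.field (Q T) (i, j))

/-- Weak Hessians restrict to the elements, where they are unique; so the local Hessians in the
trace are pieces of the global one. -/
theorem tr2Mesh_apply {u : L2 Ω} (hu : u ∈ H2 Ω) (Q : BrokenHdDiv 𝒯) :
    tr2Mesh 𝒯 u Q = dDivPairing 𝒯 u Q - fieldPairing 𝒯 (D2 u) Q := by
  have h : ∀ T, D2 (restrictL2 (𝒯.subset T) u) =
      WithLp.toLp 2 fun k => restrictL2 (𝒯.subset T) (D2 u k) := fun T =>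
    ((isWeakHessian_D2 hu).restrict (𝒯.subset T)).D2_eq (𝒯.lipschitz T).isOpen
  simp only [tr2Mesh, dDivPairing, fieldPairing, ← Finset.sum_sub_distrib,
    _root_.sum_apply]
  refine Finset.sum_congr rfl fun T _ => ?_
  simp only [tr2, h, ContinuousLinearMap.comp_apply, sub_apply, innerSL_apply_apply,
    PiLp.proj_apply]
  rw [PiLp.inner_apply, Fintype.sum_prod_type]

theorem memLp_field (Q : BrokenHdDiv 𝒯) (i j : Fin d) :
    MemLp (BrokenHdDiv.field Q i j) 2 (volume.restrict Ω) :=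
  memLp_finsetSum _ fun T _ =>
    (memLp_extend (𝒯.lipschitz T).isOpen.measurableSet _).restrict Ω

theorem sum_integral_mul_field (N : L2mat Ω) (Q : BrokenHdDiv 𝒯) :
    ∑ i, ∑ j, ∫ x in Ω, N (i, j) x * BrokenHdDiv.field Q i j x = fieldPairing 𝒯 N Q := by
  have h : ∀ i j, ∫ x in Ω, N (i, j) x * BrokenHdDiv.field Q i j x = ∑ T,
      inner ℝ (restrictL2 (𝒯.subset T) (N (i, j))) (HdDiv.field (Q T) (i, j)) := by
    intro i j
    simp only [BrokenHdDiv.field, Finset.mul_sum]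
    rw [integral_finsetSum]
    · refine Finset.sum_congr rfl fun T _ => ?_
      have hm := (𝒯.lipschitz T).isOpen.measurableSet
      simp only [← Set.indicator_mul_right]
      rw [setIntegral_indicator hm, Set.inter_eq_right.2 (𝒯.subset T), inner_L2]
      exact integral_congr_ae ((restrictL2_ae (𝒯.subset T) (N (i, j))).mono fun x hx => by
        simp [hx])
    · intro T _
      exact (Lp.memLp (N (i, j))).integrable_mul
        ((memLp_extend (𝒯.lipschitz T).isOpen.measurableSet _).restrict Ω)
  simp only [h, fieldPairing]
  rw [Finset.sum_comm]
  conv_rhs => rw [Finset.sum_comm]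
  rw [Finset.sum_comm]
  exact Finset.sum_congr rfl fun i _ => Finset.sum_comm

/-! ### Smooth test fields -/

theorem memLp_dDivClassical {Q : Fin d → Fin d → E d → ℝ} (hQ : IsSmoothSym Q)
    (μ : Measure (E d)) [IsFiniteMeasureOnCompacts μ] : MemLp (dDivClassical Q) 2 μ :=
  memLp_finsetSum _ fun i _ => memLp_finsetSum _ fun j _ =>
    (pderiv_contDiff i (pderiv_contDiff j (hQ.smooth i j))).continuous.memLp_of_hasCompactSupport
      (hasCompactSupport_pderiv i (hasCompactSupport_pderiv j (hQ.compact i j)))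

/-- The restriction to `S` of a smooth symmetric matrix field as an element of `H(div Div; S)`. -/
def IsSmoothSym.toHdDiv {Q : Fin d → Fin d → E d → ℝ} (hQ : IsSmoothSym Q) (S : Set (E d)) :
    HdDiv S :=
  ⟨WithLp.toLp 2 (WithLp.toLp 2 fun k : Fin d × Fin d =>
      ((hQ.smooth k.1 k.2).continuous.memLp_of_hasCompactSupport (p := 2)
        (μ := volume.restrict S) (hQ.compact k.1 k.2)).toLp _,
      (memLp_dDivClassical hQ (volume.restrict S)).toLp _),
    (smoothGraph S).le_topologicalClosure
      ⟨Q, hQ, fun i j => ((hQ.smooth i j).continuous.memLp_of_hasCompactSupport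
        (hQ.compact i j)).coeFn_toLp, (memLp_dDivClassical hQ _).coeFn_toLp⟩⟩

theorem IsSmoothSym.field_toHdDiv {Q : Fin d → Fin d → E d → ℝ} (hQ : IsSmoothSym Q)
    (S : Set (E d)) (i j : Fin d) :
    HdDiv.field (hQ.toHdDiv S) (i, j) =ᵐ[volume.restrict S] Q i j :=
  ((hQ.smooth i j).continuous.memLp_of_hasCompactSupport (hQ.compact i j)).coeFn_toLp

theorem IsSmoothSym.dDiv_toHdDiv {Q : Fin d → Fin d → E d → ℝ} (hQ : IsSmoothSym Q)
    (S : Set (E d)) : HdDiv.dDiv (hQ.toHdDiv S) =ᵐ[volume.restrict S] dDivClassical Q :=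
  (memLp_dDivClassical hQ _).coeFn_toLp

theorem dDivPairing_smooth {Q : Fin d → Fin d → E d → ℝ} (hQ : IsSmoothSym Q) (u : L2 Ω) :
    dDivPairing 𝒯 u (WithLp.toLp 2 fun T => hQ.toHdDiv (𝒯.elem T)) =
      ∫ x in Ω, u x * dDivClassical Q x := by
  have hint : IntegrableOn (fun x => u x * dDivClassical Q x) Ω :=
    (Lp.memLp u).integrable_mul (memLp_dDivClassical hQ _)
  rw [← 𝒯.sum_setIntegral hint]
  refine Finset.sum_congr rfl fun T _ => ?_
  refine (inner_L2_of_ae _ _ (hQ.dDiv_toHdDiv _)).trans ?_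
  exact integral_congr_ae ((restrictL2_ae (𝒯.subset T) u).mono fun x hx => by
    simp [hx])

theorem fieldPairing_smooth {Q : Fin d → Fin d → E d → ℝ} (hQ : IsSmoothSym Q) (N : L2mat Ω) :
    fieldPairing 𝒯 N (WithLp.toLp 2 fun T => hQ.toHdDiv (𝒯.elem T)) =
      ∑ i, ∑ j, ∫ x in Ω, N (i, j) x * Q i j x := by
  have h : ∀ i j, ∫ x in Ω, N (i, j) x * Q i j x =
      ∑ T, ∫ x in 𝒯.elem T, N (i, j) x * Q i j x := fun i j => by
    have hint : IntegrableOn (fun x => N (i, j) x * Q i j x) Ω :=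
      (Lp.memLp (N (i, j))).integrable_mul
        ((hQ.smooth i j).continuous.memLp_of_hasCompactSupport (p := 2) (hQ.compact i j))
    exact (𝒯.sum_setIntegral hint).symm
  simp only [h]
  conv_rhs => enter [2, i]; rw [Finset.sum_comm]
  rw [Finset.sum_comm]
  refine Finset.sum_congr rfl fun T _ => Finset.sum_congr rfl fun i _ =>
    Finset.sum_congr rfl fun j _ => ?_
  refine (inner_L2_of_ae _ _ (hQ.field_toHdDiv _ i j)).trans ?_
  exact integral_congr_ae ((restrictL2_ae (𝒯.subset T) (N (i, j))).mono fun x hx => by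
    simp [hx])

end Pairings

/-- The symmetric matrix field `φ (e_i ⊗ e_j + e_j ⊗ e_i)`. -/
def symField (φ : E d → ℝ) (i j k l : Fin d) : E d → ℝ :=
  ((if k = i then if l = j then (1 : ℝ) else 0 else 0) +
    if k = j then if l = i then (1 : ℝ) else 0 else 0) • φ

theorem isSmoothSym_symField {φ : E d → ℝ} (hφ : IsTestFunction Set.univ φ) (i j : Fin d) :
    IsSmoothSym (symField φ i j) := by
  refine ⟨fun k l => (hφ.smul _).smooth, fun k l => (hφ.smul _).compact, fun k l => ?_⟩
  rw [symField, symField]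
  congr 1
  grind

theorem sum_symField (a : Fin d → Fin d → ℝ) (i j : Fin d) :
    ∑ k, ∑ l, ((if k = i then if l = j then (1 : ℝ) else 0 else 0) +
      if k = j then if l = i then (1 : ℝ) else 0 else 0) * a k l = a i j + a j i := by
  simp [add_mul, Finset.sum_add_distrib, ite_mul]

theorem dDivClassical_symField {φ : E d → ℝ} (hφ : IsTestFunction Set.univ φ) (i j : Fin d)
    (x : E d) : dDivClassical (symField φ i j) x = 2 * pderiv i (pderiv j φ) x := by
  have h : ∀ k l, pderiv k (pderiv l (symField φ i j k l)) x =
      ((if k = i then if l = j then (1 : ℝ) else 0 else 0) +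
        if k = j then if l = i then (1 : ℝ) else 0 else 0) * pderiv k (pderiv l φ) x := by
    intro k l
    rw [symField, pderiv_smul _ _ hφ.smooth, pderiv_smul _ _ (hφ.pderiv l).smooth]
    rfl
  rw [dDivClassical]
  simp only [h]
  rw [sum_symField (fun k l => pderiv k (pderiv l φ) x), pderiv_comm j i hφ.smooth]
  ring

/-- Only symmetric fields may be tested with, so an off-diagonal entry is reached together with its
mirror image. Symmetry of `N` merges the two, and the factor 2 matches the one in
`dDivClassical_symField`. -/
theorem sum_integral_mul_symField {Ω : Set (E d)} {N : L2mat Ω} (hN : N ∈ L2sym Ω)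
    (φ : E d → ℝ) (i j : Fin d) :
    ∑ k, ∑ l, ∫ x in Ω, N (k, l) x * symField φ i j k l x = 2 * ∫ x in Ω, N (i, j) x * φ x := by
  have h : ∀ k l, ∫ x in Ω, N (k, l) x * symField φ i j k l x =
      ((if k = i then if l = j then (1 : ℝ) else 0 else 0) +
        if k = j then if l = i then (1 : ℝ) else 0 else 0) * ∫ x in Ω, N (k, l) x * φ x := by
    intro k l
    rw [← integral_const_mul]
    exact integral_congr_ae (ae_of_all _ fun x => by
      simp only [symField, Pi.smul_apply, smul_eq_mul]
      ring)
  simp only [h]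
  rw [sum_symField (fun k l => ∫ x in Ω, N (k, l) x * φ x), hN j i]
  ring

/-! ### Boundedness of the coefficient -/

/-- The Cordes condition bounds the Frobenius norm by the trace, which is the sum of the eigenvalues
and hence at most `d * lmax`. -/
theorem abs_entry_le_of_cordes (hd : 2 ≤ d) {A : Matrix (Fin d) (Fin d) ℝ} (hA : A.IsSymm)
    {lmin lmax ε : ℝ} (hlmin : 0 < lmin) (hs : ∀ μ ∈ spectrum ℝ A, lmin ≤ μ ∧ μ ≤ lmax)
    (hε : 0 < ε) (hc : (∑ j, ∑ k, A j k ^ 2) / (∑ j, A j j) ^ 2 ≤ 1 / ((d : ℝ) - 1 + ε))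
    (i j : Fin d) : |A i j| ≤ d * lmax := by
  have hH : A.IsHermitian := by
    rw [Matrix.IsHermitian, Matrix.conjTranspose_eq_transpose_of_trivial]
    exact hA
  have hd' : (2 : ℝ) ≤ d := by exact_mod_cast hd
  have htr : ∑ j, A j j = ∑ i, hH.eigenvalues i := hH.trace_eq_sum_eigenvalues
  have heig := fun i => hs _ (hH.eigenvalues_mem_spectrum_real i)
  -- With trace zero the quotient in the Cordes condition would be `0` by convention and carry no
  -- information.
  have hpos : 0 < ∑ j, A j j := by
    rw [htr]
    exact Finset.sum_pos (fun i _ => hlmin.trans_le (heig i).1) ⟨i, Finset.mem_univ i⟩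
  have hle : ∑ j, A j j ≤ d * lmax := by
    rw [htr]
    refine (Finset.sum_le_sum fun i _ => (heig i).2).trans ?_
    simp
  -- Since `d ≥ 2`, the denominator `d - 1 + ε` is at least one.
  have h1 : (∑ j, ∑ k, A j k ^ 2) / (∑ j, A j j) ^ 2 ≤ 1 :=
    hc.trans ((div_le_one (by linarith)).2 (by linarith))
  rw [div_le_one (by positivity)] at h1
  have h2 : A i j ^ 2 ≤ ∑ j, ∑ k, A j k ^ 2 :=
    (Finset.single_le_sum (f := fun k => A i k ^ 2) (fun k _ => sq_nonneg _)
      (Finset.mem_univ j)).trans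
    (Finset.single_le_sum (f := fun i => ∑ k, A i k ^ 2)
      (fun k _ => Finset.sum_nonneg fun _ _ => sq_nonneg _) (Finset.mem_univ i))
  exact (abs_le_of_sq_le_sq (h2.trans h1) hpos.le).trans hle

theorem IsCordesCoefficient.exists_bound (hd : 2 ≤ d) {Ω : Set (E d)}
    {A : E d → Matrix (Fin d) (Fin d) ℝ} (hA : IsCordesCoefficient Ω A) :
    ∃ C : ℝ, ∀ᵐ x ∂volume.restrict Ω, ∀ i j, |A x i j| ≤ C := by
  obtain ⟨lmin, lmax, hlmin, hs⟩ := hA.elliptic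
  obtain ⟨ε, hε, -, hc⟩ := hA.cordes
  refine ⟨d * lmax, ?_⟩
  filter_upwards [hA.symm, hs, hc] with x h1 h2 h3 i j
  exact abs_entry_le_of_cordes hd h1 hlmin h2 hε h3 i j

theorem IsCordesCoefficient.memLp_contract (hd : 2 ≤ d) {Ω : Set (E d)}
    {A : E d → Matrix (Fin d) (Fin d) ℝ} (hA : IsCordesCoefficient Ω A) (M : L2mat Ω) :
    MemLp (fun x => ∑ i, ∑ j, A x i j * M (i, j) x) 2 (volume.restrict Ω) := by
  obtain ⟨C, hC⟩ := hA.exists_bound hd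
  refine memLp_finsetSum _ fun i _ => memLp_finsetSum _ fun j _ => ?_
  refine (Lp.memLp (M (i, j))).of_le_mul (c := C)
    ((hA.measurable i j).mul (Lp.aestronglyMeasurable _)) ?_
  filter_upwards [hC] with x hx
  rw [norm_mul]
  exact mul_le_mul_of_nonneg_right (hx i j) (norm_nonneg _)

/-! ### The bilinear form -/

section Form

variable {Ω : Set (E d)} {ι : Type*} [Fintype ι] (𝒯 : Mesh Ω ι)

/-- Boundedness of `A` puts `A : M` in `L²`, so `(M, A v)` splits off as `(A : M, v)` and the `v`-
and `Q`-parts separate. -/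
theorem b_eq (hd : 2 ≤ d) {A : E d → Matrix (Fin d) (Fin d) ℝ} (hA : IsCordesCoefficient Ω A)
    (u : L2 Ω) (M : L2mat Ω) (w : BrokenHdDiv 𝒯 →L[ℝ] ℝ) (v : L2 Ω) (Q : BrokenHdDiv 𝒯) :
    b 𝒯 A (u, M, w) (v, Q) = -dDivPairing 𝒯 u Q +
      ((∫ x in Ω, (∑ i, ∑ j, A x i j * M (i, j) x) * v x) + fieldPairing 𝒯 M Q) + w Q := by
  have hMQ : ∀ i j, Integrable (fun x => M (i, j) x * BrokenHdDiv.field Q i j x)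
      (volume.restrict Ω) := fun i j => (Lp.memLp (M (i, j))).integrable_mul (memLp_field 𝒯 Q i j)
  have hsum : Integrable (fun x => ∑ i, ∑ j, M (i, j) x * BrokenHdDiv.field Q i j x)
      (volume.restrict Ω) :=
    integrable_finsetSum _ fun i _ => integrable_finsetSum _ fun j _ => hMQ i j
  have hAM : Integrable (fun x => (∑ i, ∑ j, A x i j * M (i, j) x) * v x) (volume.restrict Ω) :=
    (hA.memLp_contract hd M).integrable_mul (Lp.memLp v)
  have e : ∫ x in Ω, ∑ i, ∑ j, M (i, j) x * (A x i j * v x + BrokenHdDiv.field Q i j x) =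
      (∫ x in Ω, (∑ i, ∑ j, A x i j * M (i, j) x) * v x) + fieldPairing 𝒯 M Q := by
    rw [← sum_integral_mul_field]
    have e2 : ∑ i, ∑ j, ∫ x in Ω, M (i, j) x * BrokenHdDiv.field Q i j x =
        ∫ x in Ω, ∑ i, ∑ j, M (i, j) x * BrokenHdDiv.field Q i j x := by
      rw [integral_finsetSum _ fun i _ => integrable_finsetSum _ fun j _ => hMQ i j]
      exact Finset.sum_congr rfl fun i _ => (integral_finsetSum _ fun j _ => hMQ i j).symm
    rw [e2, ← integral_add hAM hsum]
    refine integral_congr_ae (ae_of_all _ fun x => ?_)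
    simp only [Finset.sum_mul, ← Finset.sum_add_distrib]
    exact Finset.sum_congr rfl fun i _ => Finset.sum_congr rfl fun j _ => by ring
  simp only [b, e, dDivPairing, inner_neg_right, Finset.sum_neg_distrib]

theorem SolvesStrong.solvesUltraweak (hd : 2 ≤ d) (hΩ : IsOpen Ω)
    {A : E d → Matrix (Fin d) (Fin d) ℝ} (hA : IsCordesCoefficient Ω A) {f u : L2 Ω}
    (hu : SolvesStrong A f u) : SolvesUltraweak 𝒯 A f (u, D2 u, tr2Mesh 𝒯 u) := by
  obtain ⟨huX, hAf⟩ := hu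
  refine ⟨⟨(isWeakHessian_D2 huX.1).mem_L2sym hΩ, u, huX, rfl⟩, ?_⟩
  rintro ⟨v, Q⟩
  rw [b_eq 𝒯 hd hA, tr2Mesh_apply 𝒯 huX.1, F, inner_L2]
  have e : ∫ x in Ω, (∑ i, ∑ j, A x i j * D2 u (i, j) x) * v x = ∫ x in Ω, f x * v x :=
    integral_congr_ae (hAf.mono fun x hx => by simp only [hx])
  rw [e]
  ring

theorem SolvesUltraweak.solvesStrong (hd : 2 ≤ d) (hΩ : IsOpen Ω) (hΩc : Convex ℝ Ω)
    (hΩb : Bornology.IsBounded Ω) (hne : Ω.Nonempty)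
    {A : E d → Matrix (Fin d) (Fin d) ℝ} (hA : IsCordesCoefficient Ω A) {f u : L2 Ω}
    {M : L2mat Ω} {uhat : BrokenHdDiv 𝒯 →L[ℝ] ℝ} (h : SolvesUltraweak 𝒯 A f (u, M, uhat)) :
    SolvesStrong A f u := by
  obtain ⟨⟨hM, w, hw, rfl⟩, hb⟩ := h
  have hwH := isWeakHessian_D2 hw.1
  have hb' : ∀ (v : L2 Ω) (Q : BrokenHdDiv 𝒯), -dDivPairing 𝒯 u Q +
      ((∫ x in Ω, (∑ i, ∑ j, A x i j * M (i, j) x) * v x) + fieldPairing 𝒯 M Q) +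
      (dDivPairing 𝒯 w Q - fieldPairing 𝒯 (D2 w) Q) = ∫ x in Ω, f x * v x := by
    intro v Q
    have := hb (v, Q)
    rwa [b_eq 𝒯 hd hA, tr2Mesh_apply 𝒯 hw.1, F, inner_L2] at this
  have hAM : ∀ᵐ x ∂volume.restrict Ω, ∑ j, ∑ k, A x j k * M (j, k) x = f x := by
    have hg := hA.memLp_contract hd M
    have e : hg.toLp _ = f := ae_eq_of_forall_test hΩ fun φ hφ => by
      have h0 : ∀ N : L2mat Ω, fieldPairing 𝒯 N 0 = 0 := fun N => by simp [fieldPairing]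
      have h1 : ∀ v : L2 Ω, dDivPairing 𝒯 v 0 = 0 := fun v => by simp [dDivPairing]
      -- With `Q = 0` only `(A : M, v) = (f, v)` survives.
      have h2 := hb' ((hφ.memLp 2 _).toLp φ) 0
      simp only [h0, h1, neg_zero, zero_add, add_zero, sub_zero] at h2
      have hφe := (hφ.memLp 2 (volume.restrict Ω)).coeFn_toLp
      have e1 : ∫ x in Ω, f x * (hφ.memLp 2 (volume.restrict Ω)).toLp φ x =
          ∫ x in Ω, f x * φ x := integral_congr_ae (hφe.mono fun x hx => by simp only [hx])
      rw [← e1, ← h2]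
      refine integral_congr_ae ?_
      filter_upwards [hg.coeFn_toLp, hφe] with x hx hx'
      rw [hx, hx']
    rw [← e]
    exact hg.coeFn_toLp.symm
  have hp : ∀ φ, IsTestFunction Set.univ φ → ∀ i j,
      ∫ x in Ω, (u - w : L2 Ω) x * pderiv i (pderiv j φ) x =
        ∫ x in Ω, (M - D2 w) (i, j) x * φ x := by
    intro φ hφ i j
    have hsub : ∀ (v v' : L2 Ω) (ψ : E d → ℝ), IsTestFunction Set.univ ψ →
        ∫ x in Ω, (v - v' : L2 Ω) x * ψ x =
          (∫ x in Ω, v x * ψ x) - ∫ x in Ω, v' x * ψ x := fun v v' ψ hψ => by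
      rw [← integral_sub (integrable_L2_mul_test v hψ) (integrable_L2_mul_test v' hψ)]
      exact integral_congr_ae ((Lp.coeFn_sub v v').mono fun x hx => by
        beta_reduce; rw [hx, Pi.sub_apply, sub_mul])
    have hQ := isSmoothSym_symField hφ i j
    -- With `v = 0` and a globally smooth `Q` not vanishing on `∂Ω`, the equation says that the zero
    -- extensions satisfy the Hessian relation across `∂Ω`.
    have h1 := hb' 0 (WithLp.toLp 2 fun T => hQ.toHdDiv (𝒯.elem T))
    have h2 : ∀ g : E d → ℝ, ∫ x in Ω, g x * (0 : L2 Ω) x = 0 := fun g => by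
      rw [← integral_zero (E d) ℝ]
      exact integral_congr_ae ((Lp.coeFn_zero ℝ 2 (volume.restrict Ω)).mono fun x hx => by
        beta_reduce; rw [hx, Pi.zero_apply, mul_zero])
    have h3 : ∀ v : L2 Ω, ∫ x in Ω, v x * dDivClassical (symField φ i j) x =
        2 * ∫ x in Ω, v x * pderiv i (pderiv j φ) x := fun v => by
      rw [← integral_const_mul]
      exact integral_congr_ae (ae_of_all _ fun x => by
        simp only [dDivClassical_symField hφ]
        ring)
    rw [dDivPairing_smooth, dDivPairing_smooth, fieldPairing_smooth, fieldPairing_smooth, h2, h2,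
      h3, h3, sum_integral_mul_symField hM, sum_integral_mul_symField (hwH.mem_L2sym hΩ)] at h1
    rw [hsub _ _ _ ((hφ.pderiv j).pderiv i)]
    refine Eq.trans ?_ (hsub (M (i, j)) (D2 w (i, j)) φ hφ).symm
    linarith
  obtain ⟨hz0, hzH⟩ := mem_X_of_mem_closure (mem_closure_testGraph hΩ hΩc hΩb hne
    (p := WithLp.toLp 2 (u - w, M - D2 w)) hp)
  have hu0 : u ∈ H10 Ω := by
    have := H10_add hw.2 hz0
    rwa [WithLp.toLp_fst, add_sub_cancel] at this
  have huH : IsWeakHessian Ω u M := by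
    have := hwH.add hzH
    rwa [WithLp.toLp_fst, WithLp.toLp_snd, add_sub_cancel, add_sub_cancel] at this
  refine ⟨⟨⟨M, huH⟩, hu0⟩, ?_⟩
  rw [huH.D2_eq hΩ]
  exact hAM

end Form

end Ultraweak

end

theorem mainTheorem10 {d : ℕ} (hd : d = 2 ∨ d = 3) {Ω : Set (Ultraweak.E d)}
    (hΩ : Ultraweak.IsConvexPolytopalDomain Ω) {ι : Type*} [Fintype ι] (𝒯 : Ultraweak.Mesh Ω ι)
    (A : Ultraweak.E d → Matrix (Fin d) (Fin d) ℝ) (hA : Ultraweak.IsCordesCoefficient Ω A)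
    (f : Ultraweak.L2 Ω) :
    (∀ u : Ultraweak.L2 Ω, Ultraweak.SolvesStrong A f u →
      Ultraweak.SolvesUltraweak 𝒯 A f (u, Ultraweak.D2 u, Ultraweak.tr2Mesh 𝒯 u)) ∧
    (∀ (u : Ultraweak.L2 Ω) (M : Ultraweak.L2mat Ω)
      (uhat : Ultraweak.BrokenHdDiv 𝒯 →L[ℝ] ℝ),
      Ultraweak.SolvesUltraweak 𝒯 A f (u, M, uhat) → Ultraweak.SolvesStrong A f u) := by
  have hd2 : 2 ≤ d := by omega
  obtain ⟨hne, P, rfl⟩ := hΩ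
  have hb : Bornology.IsBounded (interior (convexHull ℝ (P : Set (Ultraweak.E d)))) :=
    (isBounded_convexHull.2 P.finite_toSet.isBounded).subset interior_subset
  exact ⟨fun u hu => hu.solvesUltraweak 𝒯 hd2 isOpen_interior hA, fun u M uhat h =>
    h.solvesStrong 𝒯 hd2 isOpen_interior (convex_convexHull ℝ _).interior hb hne hA⟩
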